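/- Conventions: $\hat g(\omega)=\int_{\mathbb R}g(t)e^{-2\pi i\omega t}\,dt$ (extended to $L^2(\mathbb R)$ by Plancherel) and $(f\star g)(t)=\int_{\mathbb R}f(s)g(t-s)\,ds$. Let $\psi:\mathbb R\to\mathbb C$ belong to $L^1\cap L^2(\mathbb R)$ with $\int_{\mathbb R}\psi=0$, and for $j\in\mathbb Z$ put $\psi_j(t)=2^{-j}\psi(2^{-j}t)$, so that $\hat\psi_j(\omega)=\hat\psi(2^j\omega)$. Define the scattering propagator by $U[\emptyset]f=f$ and $U[(j_1,\dots,j_n)]f=\big|U[(j_1,\dots,j_{n-1})]f\star\psi_{j_n}\big|$. For $J\in\mathbb Z$ let $\mathcal P_J$ be the set of finite sequences (paths) $p=(j_1,\dots,j_n)$ of integers with all $j_i\le J$, and $|p|=n$ the length of $p$. For $x>0$ let $\chi_x(t)=\sqrt\pi\,x\,e^{-(\pi x)^2t^2}$, so that $\hat\chi_x(\omega)=e^{-(\omega/x)^2}$. Assume: 1. $\frac12\sum_{j\in\mathbb Z}\big(|\hat\psi_j(\omega)|^2+|\hat\psi_j(-\omega)|^2\big)\le1$ for all $\omega\in\mathbb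 R$; 2. $|\hat\psi_j(-\omega)|\le|\hat\psi_j(\omega)|$ for all $j\in\mathbb Z$ and $\omega>0$, and for each $\omega>0$ the inequality is strict for at least one $j$; 3. for some $\epsilon>0$, $\hat\psi(\omega)=O(|\omega|^{1+\epsilon})$ as $\omega\to0$. Then for every $J\in\mathbb Z$ there exist $r>0$ and $a>1$ such that, for all $n\ge2$ and all real-valued $f\in L^2(\mathbb R)$, the functions $U[p]f$ (with $p\in\mathcal P_J$, $|p|=n$) and $f\star\chi_{ra^n}$ are in $L^2(\mathbb R)$, the sum below converges, and $$\sum_{p\in\mathcal P_J,\ |p|=n}\|U[p]f\|_2^2\;\le\;\|f\|_2^2-\|f\star\chi_{ra^n}\|_2^2\;=\;\int_{\mathbb R}|\hat f(\omega)|^2\big(1-|\hat\chi_{ra^n}(\omega)|^2\big)\,d\omega .$$ -/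

import Mathlib

open MeasureTheory Filter Topology Asymptotics FourierTransform

noncomputable section

/-- Convolution of complex-valued functions on the real line,
`(f ⋆ g)(t) = ∫ f(s) g(t - s) ds`. -/
def conv (f g : ℝ → ℂ) : ℝ → ℂ :=
  convolution f g (ContinuousLinearMap.mul ℂ ℂ) volume

/-- A mother wavelet: `ψ ∈ L¹ ∩ L²(ℝ)`, complex-valued, with zero mean. -/
structure IsMotherWavelet (ψ : ℝ → ℂ) : Prop where
  integrable : Integrable ψ volume
  memLp_two : MemLp ψ 2 volume
  integral_eq_zero : ∫ t, ψ t = 0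

/-- The dilated wavelet `ψ_j(t) = 2^{-j} ψ(2^{-j} t)`. -/
def wavelet (ψ : ℝ → ℂ) (j : ℤ) (t : ℝ) : ℂ :=
  (((2 : ℝ) ^ (-j) : ℝ) : ℂ) * ψ ((2 : ℝ) ^ (-j) * t)

/-- One step of the cascade: `f ↦ |f ⋆ ψ_j|`. -/
def waveletModulus (ψ : ℝ → ℂ) (f : ℝ → ℂ) (j : ℤ) (t : ℝ) : ℂ :=
  ((‖conv f (wavelet ψ j) t‖ : ℝ) : ℂ)

/-- The scattering propagator: `U[∅] f = f` and
`U[(j₁, …, jₙ)] f = |U[(j₁, …, jₙ₋₁)] f ⋆ ψ_{jₙ}|`. -/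
def scatteringU (ψ : ℝ → ℂ) (p : List ℤ) (f : ℝ → ℂ) : ℝ → ℂ :=
  p.foldl (waveletModulus ψ) f

/-- The paths of length `n` with all scales at most `J`. -/
def pathsOfLength (J : ℤ) (n : ℕ) : Set (List ℤ) :=
  {p | (∀ j ∈ p, j ≤ J) ∧ p.length = n}

/-- The Gaussian `χ_x(t) = √π x exp(-(π x)² t²)`, as a complex-valued function. -/
def gaussianChi (x : ℝ) (t : ℝ) : ℂ :=
  ((Real.sqrt Real.pi * x * Real.exp (-(Real.pi * x) ^ 2 * t ^ 2) : ℝ) : ℂ)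

/-- The squared `L²(ℝ)` norm (meaningful for square-integrable functions). -/
def normSqL2 (f : ℝ → ℂ) : ℝ := (eLpNorm f 2 volume).toReal ^ 2

/-- The complexification of a real-valued function. -/
def toComplexFun (f : ℝ → ℝ) (t : ℝ) : ℂ := (f t : ℂ)

theorem memLp_toComplexFun {f : ℝ → ℝ} (hf : MemLp f 2 volume) :
    MemLp (toComplexFun f) 2 volume := hf.ofReal

/-- The (Plancherel) Fourier transform of a real-valued function `f ∈ L²(ℝ)`, with the
convention `f̂(ω) = ∫ f(t) exp(-2πiωt) dt`. -/
def fourierL2 (f : ℝ → ℝ) (hf : MemLp f 2 volume) : Lp ℂ 2 (volume : Measure ℝ) :=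
  𝓕 ((memLp_toComplexFun hf).toLp (toComplexFun f))

end

/-!
The cascade `f ↦ |f ⋆ ψ_j|` pushes energy towards low frequencies, and the theorem quantifies this
by induction on the length of the paths.

**Modulus and low frequencies.** If `θ ≥ 0` then `|h ⋆ (θ e^{2πiξ·})| ≤ |h| ⋆ θ` pointwise, for every
frequency `ξ`. By Plancherel and the convolution theorem in `L²` (`l2Fourier_conv`), the energy of
`|h|` outside the window `|θ̂|²` is therefore at most the energy of `h` outside any translate of that
window (`lintegral_spectralDensity_norm_le`). For `h = f ⋆ ψ_j` the translate may be adapted to the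
frequency band of `ψ_j`. Since the spectral density of a real `f` is even, everything reduces to
inequalities between weights at a frequency `ω > 0`, in terms of `D = |ψ̂|²` and the dyadic dilates
`D(±2ʲω)`, whose total mass is at most `2` (`tsum_lintegral_spectralDensity_le`).

**Induction step.** For the Gaussian window of width `x`, the weight is `φ((ω/x)²)` with
`φ(t) = 1 - e⁻²ᵗ` concave and `φ(0) = 0`. Translating by `c 2⁻ʲ` at scale `j` and using Jensen's
inequality, it suffices to bound the mean square
`∑_j D(2ʲω) (ω - c 2⁻ʲ)² + D(-2ʲω) (ω + c 2⁻ʲ)²` by `2 (1 - κ) ω²`. The term of first order in `c` is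
negative, of order `c ω²`, because `D(-u) ≤ D(u)` with a strict inequality at some scale comparable to
`ω` (`exists_gap`, a compactness argument on one octave) unless that scale is absent from the sum, in
which case its mass is missing; the term of second order is `O(c² ω²)`
because `D` vanishes at `0` to an order greater than `2` (`exists_moment_le`). So a small `c` works
(`exists_sum_quadratic_le`), and the width of the Gaussian is multiplied by `a = (1 - κ)^{-1/2}`
at each step (`exists_cascadeEnergy_succ_le`), whatever the scales allowed.

**Base case.** It is here that scales are bounded by `J`: one step of the cascade misses at
least half of the energy in a fixed neighbourhood of the frequency `0`, hence all that lies in a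
window `|θ̂|² ≤ 1 / 2` with `θ ≥ 0` band-limited to that neighbourhood. For paths of
length `2`, averaging the translates of this window over `|ξ| ≤ β 2⁻ʲ` shows that a proportion at least
of order `1 / ω` of the energy at frequency `ω` is lost, while at low frequencies the energy that
passes is `O(ω²)`. Both are better than a Gaussian of small width (`exists_sum_weighted_le`,
`exists_cascadeEnergy_two_le`).
-/

noncomputable section

namespace Scattering

/-! ### The Fourier transform on `L²(ℝ)` -/

/-- The Plancherel Fourier transform of a square-integrable function, as a function defined
everywhere (and `0` if `h` is not square-integrable). -/
def l2Fourier (h : ℝ → ℂ) : ℝ → ℂ := by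
  classical
  exact if hh : MemLp h 2 volume then ⇑(𝓕 (hh.toLp h) : Lp ℂ 2 (volume : Measure ℝ)) else 0

/-- The spectral density `|ĥ|²`, with values in `[0, ∞]`. -/
def spectralDensity (h : ℝ → ℂ) (ω : ℝ) : ENNReal := ‖l2Fourier h ω‖ₑ ^ 2

/-- The squared `L²` norm, with values in `[0, ∞]`. -/
def energy (h : ℝ → ℂ) : ENNReal := ∫⁻ t, ‖h t‖ₑ ^ 2

theorem l2Fourier_eq {h : ℝ → ℂ} (hh : MemLp h 2 volume) :
    l2Fourier h = ⇑(𝓕 (hh.toLp h) : Lp ℂ 2 (volume : Measure ℝ)) := by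
  simp [l2Fourier, hh]

theorem memLp_l2Fourier (h : ℝ → ℂ) : MemLp (l2Fourier h) 2 volume := by
  by_cases hh : MemLp h 2 volume
  · rw [l2Fourier_eq hh]; exact Lp.memLp _
  · simp [l2Fourier, hh]

theorem measurable_l2Fourier (h : ℝ → ℂ) : Measurable (l2Fourier h) := by
  by_cases hh : MemLp h 2 volume
  · rw [l2Fourier_eq hh]; exact (Lp.stronglyMeasurable _).measurable
  · simp only [l2Fourier, hh, dif_neg, not_false_iff]; exact measurable_const

theorem measurable_spectralDensity (h : ℝ → ℂ) : Measurable (spectralDensity h) :=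
  (measurable_l2Fourier h).enorm.pow_const 2

theorem energy_eq_eLpNorm_sq (h : ℝ → ℂ) : energy h = eLpNorm h 2 volume ^ 2 := by
  have := eLpNorm_nnreal_pow_eq_lintegral (f := h) (μ := (volume : Measure ℝ)) (p := 2) (by simp)
  simp only [NNReal.coe_ofNat, ENNReal.rpow_ofNat, ENNReal.coe_ofNat] at this
  rw [energy, this]

theorem energy_lt_top {h : ℝ → ℂ} (hh : MemLp h 2 volume) : energy h < ⊤ := by
  rw [energy_eq_eLpNorm_sq]; exact ENNReal.pow_lt_top hh.eLpNorm_lt_top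

theorem normSqL2_eq (h : ℝ → ℂ) : normSqL2 h = (energy h).toReal := by
  rw [energy_eq_eLpNorm_sq, normSqL2, ENNReal.toReal_pow]

/-- Plancherel's theorem in terms of `eLpNorm`. -/
theorem eLpNorm_l2Fourier {h : ℝ → ℂ} (hh : MemLp h 2 volume) :
    eLpNorm (l2Fourier h) 2 volume = eLpNorm h 2 volume := by
  have h1 : ‖(𝓕 (hh.toLp h) : Lp ℂ 2 (volume : Measure ℝ))‖ = ‖hh.toLp h‖ := Lp.norm_fourier_eq _
  rw [Lp.norm_def, Lp.norm_def,
    ENNReal.toReal_eq_toReal_iff' (Lp.eLpNorm_ne_top _) (Lp.eLpNorm_ne_top _)] at h1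
  rw [l2Fourier_eq hh, h1]
  exact eLpNorm_congr_ae hh.coeFn_toLp

theorem lintegral_spectralDensity {h : ℝ → ℂ} (hh : MemLp h 2 volume) :
    ∫⁻ ω, spectralDensity h ω = energy h := by
  rw [energy_eq_eLpNorm_sq, ← eLpNorm_l2Fourier hh, ← energy_eq_eLpNorm_sq]; rfl

theorem l2Fourier_sub {u v : ℝ → ℂ} (hu : MemLp u 2 volume) (hv : MemLp v 2 volume) :
    l2Fourier (u - v) =ᵐ[volume] l2Fourier u - l2Fourier v := by
  rw [l2Fourier_eq hu, l2Fourier_eq hv, l2Fourier_eq (hu.sub hv)]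
  rw [MemLp.toLp_sub hu hv, show (𝓕 (hu.toLp u - hv.toLp v) : Lp ℂ 2 (volume : Measure ℝ))
    = 𝓕 (hu.toLp u) - 𝓕 (hv.toLp v) from map_sub (Lp.fourierTransformₗᵢ ℝ ℂ) _ _]
  exact Lp.coeFn_sub _ _

theorem continuous_fourier {u : ℝ → ℂ} (hu : Integrable u volume) : Continuous (𝓕 u) :=
  VectorFourier.fourierIntegral_continuous Real.continuous_fourierChar
    (by fun_prop) hu

theorem norm_fourier_le (u : ℝ → ℂ) (ω : ℝ) : ‖𝓕 u ω‖ ≤ ∫ t, ‖u t‖ :=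
  VectorFourier.norm_fourierIntegral_le_integral_norm _ _ _ _ _

/-- The defining identity `⟨û, φ⟩ = ⟨u, φ̂⟩` of the Fourier transform of tempered distributions,
for the Plancherel transform. -/
theorem integral_smul_l2Fourier {u : ℝ → ℂ} (hu : MemLp u 2 volume) (φ : SchwartzMap ℝ ℂ) :
    ∫ x, φ x * l2Fourier u x = ∫ x, 𝓕 (φ : ℝ → ℂ) x * u x := by
  have key := congrArg (fun T => T φ) (Lp.fourier_toTemperedDistribution_eq (hu.toLp u))
  simp only [TemperedDistribution.fourier_apply, Lp.toTemperedDistribution_apply,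
    smul_eq_mul] at key
  rw [l2Fourier_eq hu, ← key]
  apply integral_congr_ae
  filter_upwards [hu.coeFn_toLp] with x hx
  rw [hx, SchwartzMap.fourier_coe]

theorem integral_mul_fourier_eq {u v : ℝ → ℂ} (hu : Integrable u volume)
    (hv : Integrable v volume) : ∫ x, v x * 𝓕 u x = ∫ x, 𝓕 v x * u x := by
  have h2 := VectorFourier.integral_fourierIntegral_smul_eq_flip (L := innerₗ ℝ) (μ := volume)
    (ν := volume) (f := v) (g := u) Real.continuous_fourierChar (by fun_prop) hv hu
  rw [flip_innerₗ] at h2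
  exact h2.symm

/-- On `L¹ ∩ L²` the Plancherel transform is given by the Fourier integral: both represent the
same tempered distribution. -/
theorem l2Fourier_eq_fourier {u : ℝ → ℂ} (hu1 : Integrable u volume) (hu2 : MemLp u 2 volume) :
    l2Fourier u =ᵐ[volume] 𝓕 u := by
  refine ae_eq_of_integral_contDiff_smul_eq
    ((memLp_l2Fourier u).locallyIntegrable (by norm_num))
    (continuous_fourier hu1).locallyIntegrable ?_
  intro g hg hgs
  have hgs' : HasCompactSupport (fun x => (g x : ℂ)) := hgs.comp_left (g := Complex.ofReal) rfl
  have hgc : ContDiff ℝ ((⊤ : ℕ∞) : WithTop ℕ∞) (fun x => (g x : ℂ)) :=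
    Complex.ofRealCLM.contDiff.comp hg
  have key := integral_smul_l2Fourier hu2 (hgs'.toSchwartzMap hgc)
  rw [← integral_mul_fourier_eq hu1 (hgs'.toSchwartzMap hgc).integrable] at key
  exact key

/-! ### Young's inequality -/

theorem conv_apply (h g : ℝ → ℂ) (t : ℝ) : conv h g t = ∫ s, h s * g (t - s) := rfl

theorem enorm_conv_le (h g : ℝ → ℂ) (t : ℝ) :
    ‖conv h g t‖ₑ ≤ ∫⁻ s, ‖h s‖ₑ * ‖g (t - s)‖ₑ := by
  rw [conv_apply]
  refine (enorm_integral_le_lintegral_enorm _).trans_eq ?_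
  simp_rw [enorm_mul]

theorem convolutionExists_of_memLp {h g : ℝ → ℂ} (hh : MemLp h 2 volume) (hg : MemLp g 2 volume) :
    ConvolutionExists h g (ContinuousLinearMap.mul ℂ ℂ) volume := by
  intro t
  have hg' : MemLp (fun s => g (t - s)) 2 volume :=
    hg.comp_measurePreserving (Measure.measurePreserving_sub_left volume t)
  exact hh.integrable_mul hg'

theorem conv_sub_left {u v g : ℝ → ℂ} (hu : MemLp u 2 volume) (hv : MemLp v 2 volume)
    (hg : MemLp g 2 volume) : conv (u - v) g = conv u g - conv v g := by
  ext t
  have h1 := convolutionExists_of_memLp hu hg t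
  have h2 := convolutionExists_of_memLp hv hg t
  simp only [Pi.sub_apply, conv_apply, sub_mul]
  exact integral_sub h1 h2

/-- The Cauchy–Schwarz inequality for the measure with density `b`. -/
theorem sq_lintegral_mul_le {a b : ℝ → ENNReal} (ha : AEMeasurable a volume)
    (hb : AEMeasurable b volume) :
    (∫⁻ s, a s * b s) ^ 2 ≤ (∫⁻ s, a s ^ 2 * b s) * ∫⁻ s, b s := by
  have hb2 : ∀ s, b s ^ (1 / 2 : ℝ) * b s ^ (1 / 2 : ℝ) = b s := fun s => by
    rw [← ENNReal.rpow_add_of_nonneg _ _ (by norm_num) (by norm_num)]; norm_num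
  have hhol := ENNReal.lintegral_mul_le_Lp_mul_Lq (volume : Measure ℝ) Real.HolderConjugate.two_two
    (f := fun s => a s * b s ^ (1 / 2 : ℝ)) (g := fun s => b s ^ (1 / 2 : ℝ))
    (ha.mul (hb.pow_const _)) (hb.pow_const _)
  have e1 : ∀ s, ((fun s => a s * b s ^ (1 / 2 : ℝ)) * fun s => b s ^ (1 / 2 : ℝ)) s
      = a s * b s := fun s => by simp only [Pi.mul_apply]; rw [mul_assoc, hb2]
  have e2 : ∀ s, (a s * b s ^ (1 / 2 : ℝ)) ^ (2 : ℝ) = a s ^ 2 * b s := fun s => by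
    rw [ENNReal.mul_rpow_of_nonneg _ _ (by norm_num), ENNReal.rpow_two, ENNReal.rpow_two,
      sq (b s ^ (1 / 2 : ℝ)), hb2]
  have e3 : ∀ s, (b s ^ (1 / 2 : ℝ)) ^ (2 : ℝ) = b s := fun s => by
    rw [ENNReal.rpow_two, sq, hb2]
  simp_rw [e1, e2, e3] at hhol
  calc _ ≤ ((∫⁻ s, a s ^ 2 * b s) ^ (1 / 2 : ℝ) * (∫⁻ s, b s) ^ (1 / 2 : ℝ)) ^ 2 := by gcongr
    _ = _ := by
      rw [mul_pow, ← ENNReal.rpow_two, ← ENNReal.rpow_mul, ← ENNReal.rpow_two, ← ENNReal.rpow_mul]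
      norm_num

/-- Young's inequality `‖h ⋆ g‖₂ ≤ ‖h‖₂ ‖g‖₁`. -/
theorem energy_conv_le {h g : ℝ → ℂ} (hh : AEStronglyMeasurable h volume)
    (hg : AEStronglyMeasurable g volume) :
    energy (conv h g) ≤ energy h * (∫⁻ t, ‖g t‖ₑ) ^ 2 := by
  have hsub : ∀ t, AEMeasurable (fun s => ‖g (t - s)‖ₑ) volume := fun t =>
    (hg.comp_quasiMeasurePreserving
      (Measure.measurePreserving_sub_left volume t).quasiMeasurePreserving).enorm
  have hI : ∀ t, ∫⁻ s, ‖g (t - s)‖ₑ = ∫⁻ s, ‖g s‖ₑ := fun t =>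
    lintegral_sub_left_eq_self (fun s => ‖g s‖ₑ) t
  have hJ : ∀ s, ∫⁻ t, ‖g (t - s)‖ₑ = ∫⁻ s, ‖g s‖ₑ := fun s =>
    lintegral_sub_right_eq_self (fun s => ‖g s‖ₑ) s
  have hmeas : AEMeasurable (Function.uncurry fun t s => ‖h s‖ₑ ^ 2 * ‖g (t - s)‖ₑ)
      ((volume : Measure ℝ).prod volume) := by
    refine AEMeasurable.mul (hh.enorm.comp_snd.pow_const 2) ?_
    exact (hg.comp_quasiMeasurePreserving
      (quasiMeasurePreserving_sub_of_right_invariant volume volume)).enorm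
  calc energy (conv h g) ≤ ∫⁻ t, (∫⁻ s, ‖h s‖ₑ ^ 2 * ‖g (t - s)‖ₑ) * ∫⁻ s, ‖g s‖ₑ := by
        refine lintegral_mono fun t => ?_
        calc ‖conv h g t‖ₑ ^ 2 ≤ (∫⁻ s, ‖h s‖ₑ * ‖g (t - s)‖ₑ) ^ 2 := by
              gcongr; exact enorm_conv_le h g t
          _ ≤ _ := by
              rw [← hI t]; exact sq_lintegral_mul_le hh.enorm (hsub t)
    _ = (∫⁻ t, ∫⁻ s, ‖h s‖ₑ ^ 2 * ‖g (t - s)‖ₑ) * ∫⁻ s, ‖g s‖ₑ := by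
        refine lintegral_mul_const'' _ ?_
        exact hmeas.lintegral_prod_right'
    _ = (∫⁻ s, ∫⁻ t, ‖h s‖ₑ ^ 2 * ‖g (t - s)‖ₑ) * ∫⁻ s, ‖g s‖ₑ := by
        rw [lintegral_lintegral_swap hmeas]
    _ = _ := by
        have : ∀ s, ∫⁻ t, ‖h s‖ₑ ^ 2 * ‖g (t - s)‖ₑ = ‖h s‖ₑ ^ 2 * ∫⁻ s, ‖g s‖ₑ := fun s => by
          rw [lintegral_const_mul' _ _ (by simp), hJ]
        simp_rw [this]
        rw [lintegral_mul_const'' _ (hh.enorm.pow_const 2), energy]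
        ring

theorem aestronglyMeasurable_conv {h g : ℝ → ℂ} (hh : AEStronglyMeasurable h volume)
    (hg : AEStronglyMeasurable g volume) : AEStronglyMeasurable (conv h g) volume :=
  (hh.convolution_integrand (ContinuousLinearMap.mul ℂ ℂ) hg).integral_prod_right'

theorem eLpNorm_conv_le {h g : ℝ → ℂ} (hh : AEStronglyMeasurable h volume)
    (hg : AEStronglyMeasurable g volume) :
    eLpNorm (conv h g) 2 volume ≤ eLpNorm h 2 volume * ∫⁻ t, ‖g t‖ₑ := by
  have := energy_conv_le hh hg
  rw [energy_eq_eLpNorm_sq, energy_eq_eLpNorm_sq, ← mul_pow] at this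
  exact (ENNReal.pow_le_pow_left_iff two_ne_zero).1 this

theorem memLp_conv {h g : ℝ → ℂ} (hh : MemLp h 2 volume) (hg : Integrable g volume) :
    MemLp (conv h g) 2 volume := by
  refine ⟨aestronglyMeasurable_conv hh.1 hg.1, ?_⟩
  exact (eLpNorm_conv_le hh.1 hg.1).trans_lt (ENNReal.mul_lt_top hh.2 hg.2)

/-! ### The convolution theorem and the modulus inequality -/

theorem ae_eq_of_forall_eLpNorm_sub_le {u v : ℝ → ℂ} (hu : AEStronglyMeasurable u volume)
    (hv : AEStronglyMeasurable v volume) {C : ENNReal} (hC : C ≠ ⊤)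
    (h : ∀ ε : ENNReal, ε ≠ 0 → eLpNorm (u - v) 2 volume ≤ C * ε) : u =ᵐ[volume] v := by
  have h0 : eLpNorm (u - v) 2 volume = 0 := by
    have ht : Tendsto (fun ε : ENNReal => C * ε) (𝓝[≠] 0) (𝓝 (C * 0)) :=
      (ENNReal.Tendsto.const_mul tendsto_id (Or.inr hC)).mono_left nhdsWithin_le_nhds
    rw [mul_zero] at ht
    exact le_antisymm (ge_of_tendsto ht (eventually_mem_nhdsWithin.mono fun ε hε => h ε hε)) (zero_le)
  rw [eLpNorm_eq_zero_iff (hu.sub hv) (by norm_num)] at h0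
  filter_upwards [h0] with x hx using sub_eq_zero.1 hx

theorem fourier_conv {u g : ℝ → ℂ} (hu : Integrable u volume) (hg : Integrable g volume) (ω : ℝ) :
    𝓕 (conv u g) ω = 𝓕 u ω * 𝓕 g ω :=
  Real.fourier_mul_convolution_eq hu hg ω

theorem integrable_conv {u g : ℝ → ℂ} (hu : Integrable u volume) (hg : Integrable g volume) :
    Integrable (conv u g) volume :=
  hu.integrable_convolution (ContinuousLinearMap.mul ℂ ℂ) hg

/-- The convolution theorem for `h ∈ L²` and `g ∈ L¹ ∩ L²`. It holds for `h ∈ L¹ ∩ L²`, and both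
sides are Lipschitz in `h` for the `L²` norm, with constant `‖g‖₁`. -/
theorem l2Fourier_conv {h g : ℝ → ℂ} (hh : MemLp h 2 volume) (hg1 : Integrable g volume)
    (hg2 : MemLp g 2 volume) :
    l2Fourier (conv h g) =ᵐ[volume] fun ω => l2Fourier h ω * 𝓕 g ω := by
  have hmeas : AEStronglyMeasurable (fun ω => l2Fourier h ω * 𝓕 g ω) volume :=
    (memLp_l2Fourier h).1.mul (continuous_fourier hg1).aestronglyMeasurable
  set C : ENNReal := ∫⁻ t, ‖g t‖ₑ with hC
  have hCtop : C ≠ ⊤ := hg1.2.ne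
  have hFg : ∀ ω, ‖𝓕 g ω‖ₑ ≤ C := fun ω => by
    have h1 := norm_fourier_le g ω
    rw [← ofReal_norm]
    refine (ENNReal.ofReal_le_ofReal h1).trans_eq ?_
    exact ofReal_integral_norm_eq_lintegral_enorm hg1
  refine ae_eq_of_forall_eLpNorm_sub_le (memLp_l2Fourier _).1 hmeas
    (C := 2 * C) (ENNReal.mul_ne_top (by norm_num) hCtop) fun ε hε => ?_
  obtain ⟨v, hvs, hve, hvc, hv2⟩ := hh.exists_hasCompactSupport_eLpNorm_sub_le (by norm_num) hε
  have hv1 : Integrable v volume := hvc.integrable_of_hasCompactSupport hvs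
  have hd : MemLp (h - v) 2 volume := hh.sub hv2
  have hcv := memLp_conv hv2 hg1
  have hch := memLp_conv hh hg1
  have e1 : l2Fourier (conv (h - v) g) =ᵐ[volume]
      l2Fourier (conv h g) - l2Fourier (conv v g) := by
    rw [conv_sub_left hh hv2 hg2]; exact l2Fourier_sub hch hcv
  have e2 : l2Fourier (conv v g) =ᵐ[volume] 𝓕 (conv v g) :=
    l2Fourier_eq_fourier (integrable_conv hv1 hg1) hcv
  have e3 := l2Fourier_eq_fourier hv1 hv2
  have e4 := l2Fourier_sub hh hv2
  have e5 : l2Fourier (conv h g) - (fun ω => l2Fourier h ω * 𝓕 g ω) =ᵐ[volume]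
      l2Fourier (conv (h - v) g) - fun ω => 𝓕 g ω • l2Fourier (h - v) ω := by
    filter_upwards [e1, e2, e3, e4] with ω h1 h2 h3 h4
    simp only [Pi.sub_apply, smul_eq_mul] at h1 h4 ⊢
    rw [h1, h4, h2, h3, fourier_conv hv1 hg1]
    ring
  rw [eLpNorm_congr_ae e5]
  have n1 : eLpNorm (l2Fourier (conv (h - v) g)) 2 volume ≤ C * ε := by
    rw [eLpNorm_l2Fourier (memLp_conv hd hg1), mul_comm]
    exact (eLpNorm_conv_le hd.1 hg1.1).trans (by gcongr)
  have n2 : eLpNorm (fun ω => 𝓕 g ω • l2Fourier (h - v) ω) 2 volume ≤ C * ε := by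
    have : eLpNorm (fun ω => 𝓕 g ω • l2Fourier (h - v) ω) 2 volume
        ≤ C * eLpNorm (l2Fourier (h - v)) 2 volume := by
      have hCC : C = (C.toNNReal : ENNReal) := (ENNReal.coe_toNNReal hCtop).symm
      rw [hCC, ← smul_eq_mul (a := (C.toNNReal : ENNReal)), ← ENNReal.smul_def]
      refine eLpNorm_le_nnreal_smul_eLpNorm_of_ae_le_mul' (Eventually.of_forall fun ω => ?_) 2
      rw [enorm_smul, ← hCC]
      gcongr
      exact hFg ω
    rw [eLpNorm_l2Fourier hd] at this
    exact this.trans (by gcongr)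
  calc _ ≤ C * ε + C * ε :=
        (eLpNorm_sub_le (memLp_l2Fourier _).1
          ((continuous_fourier hg1).aestronglyMeasurable.smul (memLp_l2Fourier _).1)
          (by norm_num)).trans (add_le_add n1 n2)
    _ = _ := by ring

theorem spectralDensity_conv {h g : ℝ → ℂ} (hh : MemLp h 2 volume) (hg1 : Integrable g volume)
    (hg2 : MemLp g 2 volume) :
    spectralDensity (conv h g) =ᵐ[volume] fun ω => spectralDensity h ω * ‖𝓕 g ω‖ₑ ^ 2 := by
  filter_upwards [l2Fourier_conv hh hg1 hg2] with ω hω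
  rw [spectralDensity, hω, enorm_mul, mul_pow, spectralDensity]

theorem energy_conv {h g : ℝ → ℂ} (hh : MemLp h 2 volume) (hg1 : Integrable g volume)
    (hg2 : MemLp g 2 volume) :
    energy (conv h g) = ∫⁻ ω, spectralDensity h ω * ‖𝓕 g ω‖ₑ ^ 2 := by
  rw [← lintegral_spectralDensity (memLp_conv hh hg1),
    lintegral_congr_ae (spectralDensity_conv hh hg1 hg2)]

theorem fourier_neg_of_real (u : ℝ → ℝ) (ω : ℝ) :
    𝓕 (toComplexFun u) (-ω) = (starRingEnd ℂ) (𝓕 (toComplexFun u) ω) := by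
  rw [Real.fourier_real_eq_integral_exp_smul, Real.fourier_real_eq_integral_exp_smul,
    ← integral_conj]
  congr 1 with t
  simp only [toComplexFun, smul_eq_mul, map_mul, Complex.conj_ofReal, ← Complex.exp_conj,
    Complex.conj_I]
  congr 2
  push_cast
  ring

/-- The transform of a real function is Hermitian. -/
theorem l2Fourier_neg_of_real {f : ℝ → ℝ} (hf : MemLp f 2 volume) :
    (fun ω => l2Fourier (toComplexFun f) (-ω)) =ᵐ[volume]
      fun ω => (starRingEnd ℂ) (l2Fourier (toComplexFun f) ω) := by
  have hneg : MeasurePreserving (fun x : ℝ => -x) volume volume := Measure.measurePreserving_neg _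
  have hmn : ∀ u : ℝ → ℂ, AEStronglyMeasurable (fun ω => l2Fourier u (-ω)) volume := fun u =>
    (memLp_l2Fourier u).1.comp_measurePreserving hneg
  have hmc : ∀ u : ℝ → ℂ, AEStronglyMeasurable
      (fun ω => (starRingEnd ℂ) (l2Fourier u ω)) volume := fun u =>
    Complex.continuous_conj.comp_aestronglyMeasurable (memLp_l2Fourier u).1
  refine ae_eq_of_forall_eLpNorm_sub_le (hmn _) (hmc _) (C := 2) (by norm_num) fun ε hε => ?_
  obtain ⟨v, hvs, hve, hvc, hv2⟩ := hf.exists_hasCompactSupport_eLpNorm_sub_le (by norm_num) hε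
  have hv1 : Integrable (toComplexFun v) volume :=
    (hvc.integrable_of_hasCompactSupport hvs).ofReal
  have hfC := memLp_toComplexFun hf
  have hvC := memLp_toComplexFun hv2
  set d : ℝ → ℂ := toComplexFun f - toComplexFun v with hd
  have hdm : MemLp d 2 volume := hfC.sub hvC
  have hdn : eLpNorm d 2 volume ≤ ε := by
    refine le_trans (eLpNorm_mono_enorm fun x => ?_) hve
    rw [hd, Pi.sub_apply, Pi.sub_apply, toComplexFun, toComplexFun, ← Complex.ofReal_sub,
      ← ofReal_norm, ← ofReal_norm, Complex.norm_real]
  have e1 := l2Fourier_sub hfC hvC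
  have e2 := l2Fourier_eq_fourier hv1 hvC
  have e5 : (fun ω => l2Fourier (toComplexFun f) (-ω)) -
      (fun ω => (starRingEnd ℂ) (l2Fourier (toComplexFun f) ω)) =ᵐ[volume]
      (fun ω => l2Fourier d (-ω)) - fun ω => (starRingEnd ℂ) (l2Fourier d ω) := by
    filter_upwards [e1, e2, hneg.quasiMeasurePreserving.ae e1,
      hneg.quasiMeasurePreserving.ae e2] with ω h1 h2 h3 h4
    simp only [Pi.sub_apply] at h1 h3 ⊢
    rw [h1, h3, h2, h4, fourier_neg_of_real, map_sub]
    ring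
  rw [eLpNorm_congr_ae e5]
  have n1 : eLpNorm (fun ω => l2Fourier d (-ω)) 2 volume ≤ ε := by
    have := eLpNorm_comp_measurePreserving (p := 2) (memLp_l2Fourier d).1 hneg
    rw [Function.comp_def] at this
    rw [this, eLpNorm_l2Fourier hdm]
    exact hdn
  have n2 : eLpNorm (fun ω => (starRingEnd ℂ) (l2Fourier d ω)) 2 volume ≤ ε := by
    refine le_trans (eLpNorm_mono_enorm fun x => ?_) ((eLpNorm_l2Fourier hdm).trans_le hdn)
    rw [← ofReal_norm, ← ofReal_norm, Complex.norm_conj]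
  refine (eLpNorm_sub_le (hmn d) (hmc d) (by norm_num)).trans ?_
  rw [two_mul]
  exact add_le_add n1 n2

theorem spectralDensity_neg {f : ℝ → ℝ} (hf : MemLp f 2 volume) :
    (fun ω => spectralDensity (toComplexFun f) (-ω)) =ᵐ[volume]
      spectralDensity (toComplexFun f) := by
  filter_upwards [l2Fourier_neg_of_real hf] with ω hω
  rw [spectralDensity, hω, spectralDensity, ← ofReal_norm, ← ofReal_norm,
    Complex.norm_conj]

/-- Against the even density of a real function, a weight may be replaced by its even part. -/
theorem two_mul_lintegral_spectralDensity_mul {f : ℝ → ℝ} (hf : MemLp f 2 volume)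
    {w : ℝ → ENNReal} (hw : Measurable w) :
    2 * ∫⁻ ω, spectralDensity (toComplexFun f) ω * w ω =
      ∫⁻ ω, spectralDensity (toComplexFun f) ω * (w ω + w (-ω)) := by
  have h1 : ∫⁻ ω, spectralDensity (toComplexFun f) ω * w (-ω) =
      ∫⁻ ω, spectralDensity (toComplexFun f) ω * w ω := by
    rw [← lintegral_neg_eq_self]
    refine lintegral_congr_ae ?_
    filter_upwards [spectralDensity_neg hf] with ω hω
    rw [hω, neg_neg]
  simp_rw [mul_add]
  have hm : Measurable fun ω => spectralDensity (toComplexFun f) ω * w ω :=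
    (measurable_spectralDensity _).mul hw
  rw [lintegral_add_left hm, h1, two_mul]

/-- Modulation of `θ` by the frequency `ξ`. -/
def modulate (ξ : ℝ) (θ : ℝ → ℂ) (t : ℝ) : ℂ :=
  ((Real.fourierChar (ξ * t) : Circle) : ℂ) * θ t

theorem norm_modulate (ξ : ℝ) (θ : ℝ → ℂ) (t : ℝ) : ‖modulate ξ θ t‖ = ‖θ t‖ := by
  rw [modulate, norm_mul, Circle.norm_coe, one_mul]

theorem aestronglyMeasurable_modulate (ξ : ℝ) {θ : ℝ → ℂ} (hθ : AEStronglyMeasurable θ volume) :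
    AEStronglyMeasurable (modulate ξ θ) volume := by
  refine AEStronglyMeasurable.mul (Continuous.aestronglyMeasurable ?_) hθ
  have := Real.continuous_fourierChar
  fun_prop

theorem fourier_modulate (ξ : ℝ) (θ : ℝ → ℂ) (ω : ℝ) : 𝓕 (modulate ξ θ) ω = 𝓕 θ (ω - ξ) := by
  rw [Real.fourier_real_eq, Real.fourier_real_eq]
  congr 1 with t
  simp only [modulate, Circle.smul_def, smul_eq_mul]
  rw [← mul_assoc, ← Circle.coe_mul, ← AddChar.map_add_eq_mul]
  congr 3
  ring

/-- Taking the modulus can only increase the low-frequency energy: for `θ ≥ 0`, the energy of `|h|`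
seen through `θ̂` dominates that of `h` seen through any translate of `θ̂`, since
`|h ⋆ (θ e^{2πiξ·})| ≤ |h| ⋆ θ` pointwise. -/
theorem lintegral_spectralDensity_norm_ge {h : ℝ → ℂ} (hh : MemLp h 2 volume) {θ : ℝ → ℝ}
    (h0 : ∀ t, 0 ≤ θ t) (hθ1 : Integrable θ volume) (hθ2 : MemLp θ 2 volume) (ξ : ℝ) :
    ∫⁻ ω, spectralDensity h ω * ‖𝓕 (toComplexFun θ) (ω - ξ)‖ₑ ^ 2 ≤
      ∫⁻ ω, spectralDensity (fun t => ((‖h t‖ : ℝ) : ℂ)) ω * ‖𝓕 (toComplexFun θ) ω‖ₑ ^ 2 := by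
  have hθc1 : Integrable (toComplexFun θ) volume := hθ1.ofReal
  have hθc2 : MemLp (toComplexFun θ) 2 volume := memLp_toComplexFun hθ2
  have hm := aestronglyMeasurable_modulate ξ hθc1.1
  have hm1 : Integrable (modulate ξ (toComplexFun θ)) volume :=
    hθc1.mono hm (Eventually.of_forall fun t => (norm_modulate _ _ _).le)
  have hm2 : MemLp (modulate ξ (toComplexFun θ)) 2 volume :=
    hθc2.mono hm (Eventually.of_forall fun t => (norm_modulate _ _ _).le)
  have hn : MemLp (fun t => ((‖h t‖ : ℝ) : ℂ)) 2 volume := hh.norm.ofReal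
  simp_rw [← fourier_modulate]
  rw [← energy_conv hh hm1 hm2, ← energy_conv hn hθc1 hθc2]
  refine lintegral_mono fun t => ?_
  gcongr
  rw [← ofReal_norm, ← ofReal_norm]
  refine ENNReal.ofReal_le_ofReal ?_
  rw [conv_apply, conv_apply]
  have e : ∀ s, ((‖h s‖ : ℝ) : ℂ) * toComplexFun θ (t - s) = ((‖h s‖ * θ (t - s) : ℝ) : ℂ) :=
    fun s => by simp [toComplexFun]
  simp_rw [e]
  rw [integral_complex_ofReal, Complex.norm_real]
  refine (norm_integral_le_integral_norm _).trans ((le_of_eq ?_).trans (le_abs_self _))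
  congr 1 with s
  rw [norm_mul, norm_modulate, toComplexFun, Complex.norm_real, Real.norm_of_nonneg (h0 _)]

theorem energy_norm (h : ℝ → ℂ) : energy (fun t => ((‖h t‖ : ℝ) : ℂ)) = energy h := by
  simp only [energy]
  congr 1 with t
  rw [← ofReal_norm, ← ofReal_norm, Complex.norm_real, norm_norm]

/-- The complementary form of `lintegral_spectralDensity_norm_ge`. -/
theorem lintegral_spectralDensity_norm_le {h : ℝ → ℂ} (hh : MemLp h 2 volume) {θ : ℝ → ℝ}
    (h0 : ∀ t, 0 ≤ θ t) (hθ1 : Integrable θ volume) (hθ2 : MemLp θ 2 volume)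
    (hθ : ∀ ω, ‖𝓕 (toComplexFun θ) ω‖ₑ ^ 2 ≤ 1) (ξ : ℝ) :
    ∫⁻ ω, spectralDensity (fun t => ((‖h t‖ : ℝ) : ℂ)) ω *
        (1 - ‖𝓕 (toComplexFun θ) ω‖ₑ ^ 2) ≤
      ∫⁻ ω, spectralDensity h ω * (1 - ‖𝓕 (toComplexFun θ) (ω - ξ)‖ₑ ^ 2) := by
  have hn : MemLp (fun t => ((‖h t‖ : ℝ) : ℂ)) 2 volume := hh.norm.ofReal
  have hcont := continuous_fourier (u := toComplexFun θ) hθ1.ofReal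
  have split : ∀ (u : ℝ → ℂ), MemLp u 2 volume → ∀ ξ : ℝ,
      (∫⁻ ω, spectralDensity u ω * ‖𝓕 (toComplexFun θ) (ω - ξ)‖ₑ ^ 2) +
      ∫⁻ ω, spectralDensity u ω * (1 - ‖𝓕 (toComplexFun θ) (ω - ξ)‖ₑ ^ 2) = energy u := by
    intro u hu ξ
    rw [← lintegral_spectralDensity hu, ← lintegral_add_left]
    · congr 1 with ω
      rw [← mul_add, add_tsub_cancel_of_le (hθ _), mul_one]
    · have : Continuous fun ω => 𝓕 (toComplexFun θ) (ω - ξ) := by fun_prop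
      exact (measurable_spectralDensity u).mul (this.measurable.enorm.pow_const 2)
  have s1 := split _ hh ξ
  have s2 := split _ hn 0
  simp only [sub_zero] at s2
  have hle := lintegral_spectralDensity_norm_ge hh h0 hθ1 hθ2 ξ
  rw [energy_norm, ← s1] at s2
  have hfin : ∫⁻ ω, spectralDensity h ω * ‖𝓕 (toComplexFun θ) (ω - ξ)‖ₑ ^ 2 ≠ ⊤ := by
    have := energy_lt_top hh
    rw [← s1] at this
    exact (lt_of_le_of_lt le_self_add this).ne
  refine (ENNReal.add_le_add_iff_left hfin).1 ?_
  rw [← s2]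
  gcongr

/-! ### Pointwise inequalities for a Littlewood–Paley density -/

/-- The properties of `D = |ψ̂|²` that drive the decay: the dyadic dilates of `D` have total mass at
most `2` (counting both signs), positive frequencies dominate, strictly for some scale, and
`D` vanishes at `0` to an order greater than `2`. -/
structure IsAnalyticDensity (D : ℝ → ℝ) : Prop where
  nonneg : ∀ u, 0 ≤ D u
  continuous : Continuous D
  sum_le : ∀ ω : ℝ, 0 < ω → ∀ s : Finset ℤ,
    ∑ j ∈ s, (D (2 ^ j * ω) + D (-(2 ^ j * ω))) ≤ 2
  neg_le : ∀ u : ℝ, 0 < u → D (-u) ≤ D u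
  exists_neg_lt : ∀ ω : ℝ, 0 < ω → ∃ j : ℤ, D (-(2 ^ j * ω)) < D (2 ^ j * ω)
  vanishing : ∃ e C u₀ : ℝ, 0 < e ∧ 0 < C ∧ 0 < u₀ ∧
    ∀ u : ℝ, u ≠ 0 → |u| < u₀ → D u ≤ C * |u| ^ (2 + e)

theorem summable_pow_natAbs {q : ℝ} (h0 : 0 ≤ q) (h1 : q < 1) :
    Summable fun i : ℤ => q ^ i.natAbs := by
  refine Summable.of_nat_of_neg ?_ ?_
  · simpa using summable_geometric_of_lt_one h0 h1
  · simpa using summable_geometric_of_lt_one h0 h1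

/-- The tangent line of the concave function `t ↦ 1 - e⁻²ᵗ` at `m`. -/
theorem one_sub_exp_le_tangent (t m : ℝ) :
    1 - Real.exp (-2 * t) ≤
      (1 - Real.exp (-2 * m) * (1 + 2 * m)) + 2 * Real.exp (-2 * m) * t := by
  have h := Real.add_one_le_exp (-2 * (t - m))
  have e : Real.exp (-2 * t) = Real.exp (-2 * m) * Real.exp (-2 * (t - m)) := by
    rw [← Real.exp_add]; congr 1; ring
  nlinarith [Real.exp_pos (-2 * m)]

theorem exp_neg_le_inv {y : ℝ} (hy : 0 ≤ y) :
    Real.exp (-y) ≤ (1 + y)⁻¹ := by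
  rw [Real.exp_neg]
  have := Real.add_one_le_exp y
  gcongr
  linarith

namespace IsAnalyticDensity

variable {D : ℝ → ℝ}

theorem add_le_two (hD : IsAnalyticDensity D) {u : ℝ} (hu : 0 < u) : D u + D (-u) ≤ 2 := by
  simpa using hD.sum_le u hu {0}

/-- The quotient `(D(u) + D(-u)) / u²` decays polynomially both at `0` and at `∞`. -/
theorem exists_quotient_le (hD : IsAnalyticDensity D) :
    ∃ σ C : ℝ, 0 < σ ∧ 0 < C ∧ ∀ u : ℝ, 0 < u →
      (u ≤ 1 → D u + D (-u) ≤ C * u ^ σ * u ^ 2) ∧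
      (1 ≤ u → D u + D (-u) ≤ C * u ^ (-σ) * u ^ 2) := by
  obtain ⟨e, C, u₀, he, hC, hu₀, hv⟩ := hD.vanishing
  set σ := min e 2 with hσdef
  have hσ : 0 < σ := lt_min he (by norm_num)
  have hc : 0 < 2 / (u₀ ^ σ * u₀ ^ 2) := by positivity
  refine ⟨σ, 2 * C + 2 / (u₀ ^ σ * u₀ ^ 2) + 2, hσ, by positivity, fun u hu => ⟨fun h1 => ?_,
    fun h1 => ?_⟩⟩
  · rcases lt_or_ge u u₀ with h | h
    · have a1 := hv u hu.ne' (by rwa [abs_of_pos hu])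
      have a2 := hv (-u) (neg_ne_zero.2 hu.ne') (by rwa [abs_neg, abs_of_pos hu])
      rw [abs_neg] at a2
      rw [abs_of_pos hu] at a1 a2
      have hle : u ^ (2 + e) ≤ u ^ σ * u ^ 2 := by
        rw [add_comm, Real.rpow_add hu, Real.rpow_two]
        gcongr ?_ * _
        exact Real.rpow_le_rpow_of_exponent_ge hu h1 (min_le_left _ _)
      have hp : 0 ≤ u ^ σ * u ^ 2 := by positivity
      have : C * u ^ (2 + e) ≤ C * (u ^ σ * u ^ 2) := by gcongr
      nlinarith [mul_nonneg hc.le hp]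
    · have hge : u₀ ^ σ * u₀ ^ 2 ≤ u ^ σ * u ^ 2 := by gcongr
      have h3 : 2 ≤ 2 / (u₀ ^ σ * u₀ ^ 2) * (u ^ σ * u ^ 2) := by
        rw [div_mul_eq_mul_div, le_div_iff₀ (by positivity)]; linarith
      have hp : 0 ≤ u ^ σ * u ^ 2 := by positivity
      have := hD.add_le_two hu
      nlinarith [mul_nonneg hC.le hp]
  · have h2 : 1 ≤ u ^ (-σ) * u ^ 2 := by
      rw [← Real.rpow_two, ← Real.rpow_add hu]
      exact Real.one_le_rpow h1 (by linarith [min_le_right e 2])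
    have := hD.add_le_two hu
    have hp : 0 ≤ (2 * C + 2 / (u₀ ^ σ * u₀ ^ 2)) * (u ^ (-σ) * u ^ 2) := by positivity
    nlinarith

/-- Uniform bound for the second moment of the dyadic dilates. -/
theorem exists_moment_le (hD : IsAnalyticDensity D) :
    ∃ K : ℝ, 0 < K ∧ ∀ ω : ℝ, 0 < ω → ∀ s : Finset ℤ,
      ∑ j ∈ s, ((2 : ℝ) ^ j)⁻¹ ^ 2 * (D (2 ^ j * ω) + D (-(2 ^ j * ω))) ≤ K * ω ^ 2 := by
  obtain ⟨σ, C, hσ, hC, hq⟩ := hD.exists_quotient_le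
  set q : ℝ := 2 ^ (-σ) with hqdef
  have hq0 : 0 < q := by positivity
  have hq1 : q < 1 := Real.rpow_lt_one_of_one_lt_of_neg (by norm_num) (by linarith)
  have hsum := summable_pow_natAbs hq0.le hq1
  set T := ∑' i : ℤ, q ^ i.natAbs with hT
  have hTpos : 0 < T := hsum.tsum_pos (fun i => by positivity) 0 (by positivity)
  refine ⟨C * 2 ^ σ * T, by positivity, fun ω hω s => ?_⟩
  obtain ⟨k, hk1, hk2⟩ := exists_mem_Ico_zpow hω (one_lt_two : (1 : ℝ) < 2)
  have key : ∀ j : ℤ, ((2 : ℝ) ^ j)⁻¹ ^ 2 * (D (2 ^ j * ω) + D (-(2 ^ j * ω))) ≤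
      C * 2 ^ σ * ω ^ 2 * q ^ (j + k).natAbs := by
    intro j
    have h2j : (0 : ℝ) < 2 ^ j := by positivity
    have hu : 0 < (2 : ℝ) ^ j * ω := by positivity
    have hlow : (2 : ℝ) ^ (j + k) ≤ 2 ^ j * ω := by rw [zpow_add₀ (by norm_num)]; gcongr
    have hup : (2 : ℝ) ^ j * ω < 2 ^ (j + k + 1) := by
      rw [add_assoc, zpow_add₀ (by norm_num)]; gcongr
    suffices h : D (2 ^ j * ω) + D (-(2 ^ j * ω)) ≤
        C * (2 ^ σ * q ^ (j + k).natAbs) * (2 ^ j * ω) ^ 2 by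
      calc _ ≤ ((2 : ℝ) ^ j)⁻¹ ^ 2 * (C * (2 ^ σ * q ^ (j + k).natAbs) * (2 ^ j * ω) ^ 2) := by
            gcongr
        _ = _ := by field_simp
    rcases le_total (2 ^ j * ω) 1 with h | h
    · refine ((hq _ hu).1 h).trans ?_
      gcongr
      have hjk : j + k ≤ 0 := by
        have : (2 : ℝ) ^ (j + k) ≤ 2 ^ (0 : ℤ) := by simpa using hlow.trans h
        exact (zpow_le_zpow_iff_right₀ (by norm_num)).1 this
      have hn : ((j + k).natAbs : ℝ) = -((j + k : ℤ) : ℝ) := by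
        rw [Nat.cast_natAbs, abs_of_nonpos hjk]; push_cast; ring
      calc ((2 : ℝ) ^ j * ω) ^ σ ≤ ((2 : ℝ) ^ (j + k + 1)) ^ σ := by gcongr
        _ = 2 ^ σ * q ^ (j + k).natAbs := by
            rw [hqdef, ← Real.rpow_natCast, ← Real.rpow_mul (by norm_num), hn,
              ← Real.rpow_add (by norm_num), ← Real.rpow_intCast,
              ← Real.rpow_mul (by norm_num)]
            congr 1; push_cast; ring
    · refine ((hq _ hu).2 h).trans ?_
      gcongr
      have hjk : 0 ≤ j + k := by
        have : (2 : ℝ) ^ (0 : ℤ) < 2 ^ (j + k + 1) := by simpa using h.trans_lt hup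
        have := (zpow_lt_zpow_iff_right₀ (by norm_num)).1 this
        omega
      have hn : ((j + k).natAbs : ℝ) = ((j + k : ℤ) : ℝ) := by
        rw [Nat.cast_natAbs, abs_of_nonneg hjk]
      have h1σ : (1 : ℝ) ≤ 2 ^ σ := Real.one_le_rpow (by norm_num) hσ.le
      calc ((2 : ℝ) ^ j * ω) ^ (-σ) ≤ ((2 : ℝ) ^ (j + k)) ^ (-σ) :=
            Real.rpow_le_rpow_of_nonpos (by positivity) hlow (by linarith)
        _ = q ^ (j + k).natAbs := by
            rw [hqdef, ← Real.rpow_natCast, ← Real.rpow_mul (by norm_num), hn,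
              ← Real.rpow_intCast, ← Real.rpow_mul (by norm_num)]
            congr 1; ring
        _ ≤ 2 ^ σ * q ^ (j + k).natAbs := le_mul_of_one_le_left (by positivity) h1σ
  calc _ ≤ ∑ j ∈ s, C * 2 ^ σ * ω ^ 2 * q ^ (j + k).natAbs := Finset.sum_le_sum fun j _ => key j
    _ = C * 2 ^ σ * ω ^ 2 * ∑ j ∈ s, q ^ (j + k).natAbs := by rw [Finset.mul_sum]
    _ ≤ C * 2 ^ σ * ω ^ 2 * T := by
        gcongr
        rw [hT, ← (Equiv.addRight k).tsum_eq]
        exact ((Equiv.addRight k).summable_iff.2 hsum).sum_le_tsum s fun i _ => by positivity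
    _ = _ := by ring

/-- By compactness of `[1, 2]` and dyadic invariance, the asymmetry between positive and negative
frequencies is bounded below, at a scale comparable to the frequency. -/
theorem exists_gap (hD : IsAnalyticDensity D) :
    ∃ δ α β : ℝ, 0 < δ ∧ 0 < α ∧ 2 ≤ β ∧ ∀ ω : ℝ, 0 < ω → ∃ j : ℤ,
      α ≤ 2 ^ j * ω ∧ 2 ^ j * ω ≤ β ∧ δ ≤ D (2 ^ j * ω) - D (-(2 ^ j * ω)) := by
  have main : ∃ δ α β : ℝ, 0 < δ ∧ 0 < α ∧ 2 ≤ β ∧ ∀ ω ∈ Set.Icc (1 : ℝ) 2, ∃ j : ℤ,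
      α ≤ 2 ^ j * ω ∧ 2 ^ j * ω ≤ β ∧ δ ≤ D (2 ^ j * ω) - D (-(2 ^ j * ω)) := by
    refine isCompact_Icc.induction_on (p := fun s => ∃ δ α β : ℝ, 0 < δ ∧ 0 < α ∧ 2 ≤ β ∧
      ∀ ω ∈ s, ∃ j : ℤ, α ≤ 2 ^ j * ω ∧ 2 ^ j * ω ≤ β ∧
        δ ≤ D (2 ^ j * ω) - D (-(2 ^ j * ω))) ?_ ?_ ?_ ?_
    · exact ⟨1, 1, 2, by simp⟩
    · rintro s t hst ⟨δ, α, β, h1, h2, h3, h4⟩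
      exact ⟨δ, α, β, h1, h2, h3, fun ω hω => h4 ω (hst hω)⟩
    · rintro s t ⟨δ, α, β, h1, h2, h3, h4⟩ ⟨δ', α', β', h1', h2', h3', h4'⟩
      refine ⟨min δ δ', min α α', max β β', lt_min h1 h1', lt_min h2 h2', le_max_of_le_left h3,
        ?_⟩
      rintro ω (hω | hω)
      · obtain ⟨j, a, b, c⟩ := h4 ω hω
        exact ⟨j, (min_le_left _ _).trans a, b.trans (le_max_left _ _), (min_le_left _ _).trans c⟩
      · obtain ⟨j, a, b, c⟩ := h4' ω hω
        exact ⟨j, (min_le_right _ _).trans a, b.trans (le_max_right _ _),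
          (min_le_right _ _).trans c⟩
    · intro ω₀ hω₀
      have hpos : 0 < ω₀ := by linarith [hω₀.1]
      obtain ⟨j, hj⟩ := hD.exists_neg_lt ω₀ hpos
      have hc := hD.continuous
      have hcont : Continuous fun ω : ℝ => D (2 ^ j * ω) - D (-(2 ^ j * ω)) := by fun_prop
      set G := D (2 ^ j * ω₀) - D (-(2 ^ j * ω₀)) with hG
      have hGpos : 0 < G := sub_pos.2 hj
      have hev : ∀ᶠ ω in 𝓝[Set.Icc 1 2] ω₀,
          G / 2 < D (2 ^ j * ω) - D (-(2 ^ j * ω)) :=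
        (hcont.tendsto ω₀ |>.mono_left nhdsWithin_le_nhds).eventually
          (lt_mem_nhds (half_lt_self hGpos))
      refine ⟨{ω | G / 2 < D (2 ^ j * ω) - D (-(2 ^ j * ω))} ∩ Set.Icc 1 2,
        inter_mem hev self_mem_nhdsWithin, G / 2, 2 ^ j, max 2 (2 ^ j * 2), by positivity,
        by positivity, le_max_left _ _, ?_⟩
      rintro ω ⟨h1, h2, h3⟩
      refine ⟨j, le_mul_of_one_le_right (by positivity) h2, le_max_of_le_right (by gcongr),
        le_of_lt h1⟩
  obtain ⟨δ, α, β, h1, h2, h3, h4⟩ := main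
  refine ⟨δ, α, β, h1, h2, h3, fun ω hω => ?_⟩
  obtain ⟨k, hk1, hk2⟩ := exists_mem_Ico_zpow hω (one_lt_two : (1 : ℝ) < 2)
  have h2k : (0 : ℝ) < 2 ^ k := by positivity
  obtain ⟨j, hj⟩ := h4 (2 ^ (-k) * ω) ⟨by
      rw [zpow_neg, inv_mul_eq_div, le_div_iff₀ h2k]; linarith, by
      rw [zpow_neg, inv_mul_eq_div, div_le_iff₀ h2k]
      rw [zpow_add_one₀ (by norm_num)] at hk2; linarith⟩
  refine ⟨j - k, ?_⟩
  have : (2 : ℝ) ^ (j - k) * ω = 2 ^ j * (2 ^ (-k) * ω) := by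
    rw [← mul_assoc, ← zpow_add₀ (by norm_num), sub_eq_add_neg]
  rw [this]
  exact hj

theorem sum_le_of_notMem (hD : IsAnalyticDensity D) {ω δ : ℝ} (hω : 0 < ω) {j : ℤ}
    {s : Finset ℤ} (hj : j ∉ s) (hδ : δ ≤ D (2 ^ j * ω) - D (-(2 ^ j * ω))) :
    ∑ j ∈ s, (D (2 ^ j * ω) + D (-(2 ^ j * ω))) ≤ 2 - δ := by
  have h := hD.sum_le ω hω (insert j s)
  rw [Finset.sum_insert hj] at h
  linarith [hD.nonneg (-(2 ^ j * ω))]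

/-- The quadratic form of the decay: recentering the scale `j` at the frequency `c 2⁻ʲ` strictly
decreases the mean square of the frequency, because of the asymmetry of `D`. -/
theorem exists_sum_quadratic_le (hD : IsAnalyticDensity D) :
    ∃ c κ : ℝ, 0 < c ∧ 0 < κ ∧ κ < 1 ∧ ∀ ω : ℝ, 0 < ω → ∀ s : Finset ℤ,
      ∑ j ∈ s, (D (2 ^ j * ω) * (ω - c * (2 ^ j)⁻¹) ^ 2 +
        D (-(2 ^ j * ω)) * (-ω - c * (2 ^ j)⁻¹) ^ 2) ≤ 2 * ((1 - κ) * ω ^ 2) := by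
  obtain ⟨K, hK, hmom⟩ := hD.exists_moment_le
  obtain ⟨δ, α, β, hδ, hα, hβ, hgap⟩ := hD.exists_gap
  -- small enough for the second-order term to be at most half of the gain, in both cases below
  set c := min 1 (δ / (K * β)) with hc
  have hβ0 : 0 < β := by linarith
  have hcpos : 0 < c := lt_min one_pos (by positivity)
  have hc1 : c ≤ 1 := min_le_left _ _
  have hcK : c * K * β ≤ δ := by
    have : c ≤ δ / (K * β) := min_le_right _ _
    rw [le_div_iff₀ (by positivity)] at this
    linarith
  have hcK2 : c ^ 2 * K ≤ c * (δ / β) := by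
    have : c * K ≤ δ / β := by rw [le_div_iff₀ hβ0]; exact hcK
    nlinarith
  have hcK3 : c ^ 2 * K ≤ δ / 2 := by
    have h1 : c * K * 2 ≤ δ := by nlinarith [mul_pos hcpos hK]
    nlinarith [mul_pos hcpos hK]
  set κ := min (1 / 2) (min (c * (δ / β) / 2) (δ / 4)) with hκ
  have hκ1 : κ ≤ c * (δ / β) / 2 := (min_le_right _ _).trans (min_le_left _ _)
  have hκ2 : κ ≤ δ / 4 := (min_le_right _ _).trans (min_le_right _ _)
  refine ⟨c, κ, hcpos, lt_min (by norm_num) (lt_min (by positivity) (by positivity)),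
    (min_le_left _ _).trans_lt (by norm_num), fun ω hω s => ?_⟩
  have hexp : ∑ j ∈ s, (D (2 ^ j * ω) * (ω - c * (2 ^ j)⁻¹) ^ 2 +
        D (-(2 ^ j * ω)) * (-ω - c * (2 ^ j)⁻¹) ^ 2) =
      ω ^ 2 * ∑ j ∈ s, (D (2 ^ j * ω) + D (-(2 ^ j * ω))) -
      2 * c * ω * ∑ j ∈ s, ((2 : ℝ) ^ j)⁻¹ * (D (2 ^ j * ω) - D (-(2 ^ j * ω))) +
      c ^ 2 * ∑ j ∈ s, ((2 : ℝ) ^ j)⁻¹ ^ 2 * (D (2 ^ j * ω) + D (-(2 ^ j * ω))) := by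
    rw [Finset.mul_sum, Finset.mul_sum, Finset.mul_sum, ← Finset.sum_sub_distrib,
      ← Finset.sum_add_distrib]
    exact Finset.sum_congr rfl fun j _ => by ring
  rw [hexp]
  have hterm : ∀ j : ℤ, 0 ≤ ((2 : ℝ) ^ j)⁻¹ * (D (2 ^ j * ω) - D (-(2 ^ j * ω))) := fun j =>
    mul_nonneg (by positivity) (sub_nonneg.2 (hD.neg_le _ (by positivity)))
  have h3 := hmom ω hω s
  obtain ⟨j, hj1, hj2, hj3⟩ := hgap ω hω
  have hω2 : 0 < ω ^ 2 := by positivity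
  have h3' : c ^ 2 * ∑ j ∈ s, ((2 : ℝ) ^ j)⁻¹ ^ 2 * (D (2 ^ j * ω) + D (-(2 ^ j * ω))) ≤
      c ^ 2 * K * ω ^ 2 := by
    rw [mul_assoc]; gcongr
  -- either the asymmetric scale `j` contributes to the first-order term, or its mass is missing
  by_cases hjs : j ∈ s
  · have h1 := hD.sum_le ω hω s
    have h2 : ω / β * δ ≤
        ∑ j ∈ s, ((2 : ℝ) ^ j)⁻¹ * (D (2 ^ j * ω) - D (-(2 ^ j * ω))) := by
      refine le_trans ?_ (Finset.single_le_sum (fun j _ => hterm j) hjs)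
      have h2j : (0 : ℝ) < 2 ^ j := by positivity
      gcongr
      rw [inv_eq_one_div, div_le_div_iff₀ hβ0 h2j]
      linarith
    have h2' : 2 * c * ω * (ω / β * δ) ≤ 2 * c * ω *
        ∑ j ∈ s, ((2 : ℝ) ^ j)⁻¹ * (D (2 ^ j * ω) - D (-(2 ^ j * ω))) := by gcongr
    have e : 2 * c * ω * (ω / β * δ) = 2 * (c * (δ / β)) * ω ^ 2 := by ring
    rw [e] at h2'
    have h1' : ω ^ 2 * ∑ j ∈ s, (D (2 ^ j * ω) + D (-(2 ^ j * ω))) ≤ ω ^ 2 * 2 := by gcongr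
    have h5 : κ * ω ^ 2 ≤ c * (δ / β) / 2 * ω ^ 2 := by gcongr
    have h6 : c ^ 2 * K * ω ^ 2 ≤ c * (δ / β) * ω ^ 2 := by gcongr
    linarith
  · have h1 := hD.sum_le_of_notMem hω hjs hj3
    have h2 : 0 ≤ 2 * c * ω *
        ∑ j ∈ s, ((2 : ℝ) ^ j)⁻¹ * (D (2 ^ j * ω) - D (-(2 ^ j * ω))) :=
      mul_nonneg (by positivity) (Finset.sum_nonneg fun j _ => hterm j)
    have h1' : ω ^ 2 * ∑ j ∈ s, (D (2 ^ j * ω) + D (-(2 ^ j * ω))) ≤ ω ^ 2 * (2 - δ) := by gcongr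
    have h5 : κ * ω ^ 2 ≤ δ / 4 * ω ^ 2 := by gcongr
    have h6 : c ^ 2 * K * ω ^ 2 ≤ δ / 2 * ω ^ 2 := by gcongr
    linarith

/-- Jensen's inequality turns the quadratic estimate into one for Gaussians: after one step of the
cascade, the Gaussian of width `x` becomes one of width `a x`, with `a > 1`. -/
theorem exists_sum_gaussian_le (hD : IsAnalyticDensity D) :
    ∃ c a : ℝ, 1 < a ∧ ∀ x : ℝ, 0 < x → ∀ ω : ℝ, 0 < ω → ∀ s : Finset ℤ,
      ∑ j ∈ s, (D (2 ^ j * ω) * (1 - Real.exp (-2 * ((ω - c * (2 ^ j)⁻¹) / x) ^ 2)) +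
        D (-(2 ^ j * ω)) * (1 - Real.exp (-2 * ((-ω - c * (2 ^ j)⁻¹) / x) ^ 2))) ≤
      2 * (1 - Real.exp (-2 * (ω / (x * a)) ^ 2)) := by
  obtain ⟨c, κ, hc, hκ, hκ1, hquad⟩ := hD.exists_sum_quadratic_le
  have h1κ : 0 < 1 - κ := by linarith
  set a := (Real.sqrt (1 - κ))⁻¹ with ha
  have ha2 : (a ^ 2)⁻¹ = 1 - κ := by
    rw [ha, inv_pow, inv_inv, Real.sq_sqrt h1κ.le]
  have ha1 : 1 < a := by
    rw [ha]
    refine (one_lt_inv₀ (Real.sqrt_pos.2 h1κ)).2 ?_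
    rw [Real.sqrt_lt' one_pos]; linarith
  refine ⟨c, a, ha1, fun x hx ω hω s => ?_⟩
  set m := (ω / (x * a)) ^ 2 with hm
  have hm' : m = (1 - κ) * ω ^ 2 / x ^ 2 := by
    rw [hm, div_pow, mul_pow, ← ha2]; field_simp
  have hm0 : 0 ≤ m := by positivity
  set A := 1 - Real.exp (-2 * m) * (1 + 2 * m) with hA
  set B := 2 * Real.exp (-2 * m) with hB
  have hA0 : 0 ≤ A := by
    have h := one_sub_exp_le_tangent 0 m
    simp only [mul_zero, Real.exp_zero, sub_self, add_zero] at h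
    exact h
  have hB0 : 0 < B := by positivity
  have hq : ∑ j ∈ s, (D (2 ^ j * ω) * ((ω - c * (2 ^ j)⁻¹) / x) ^ 2 +
        D (-(2 ^ j * ω)) * ((-ω - c * (2 ^ j)⁻¹) / x) ^ 2) ≤ 2 * m := by
    have := hquad ω hω s
    rw [hm']
    calc _ = (∑ j ∈ s, (D (2 ^ j * ω) * (ω - c * (2 ^ j)⁻¹) ^ 2 +
        D (-(2 ^ j * ω)) * (-ω - c * (2 ^ j)⁻¹) ^ 2)) / x ^ 2 := by
          rw [Finset.sum_div]
          exact Finset.sum_congr rfl fun j _ => by ring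
      _ ≤ 2 * ((1 - κ) * ω ^ 2) / x ^ 2 := by gcongr
      _ = _ := by ring
  calc _ ≤ ∑ j ∈ s, (A * (D (2 ^ j * ω) + D (-(2 ^ j * ω))) +
        B * (D (2 ^ j * ω) * ((ω - c * (2 ^ j)⁻¹) / x) ^ 2 +
        D (-(2 ^ j * ω)) * ((-ω - c * (2 ^ j)⁻¹) / x) ^ 2)) := by
        refine Finset.sum_le_sum fun j _ => ?_
        have t1 := mul_le_mul_of_nonneg_left
          (one_sub_exp_le_tangent (((ω - c * (2 ^ j)⁻¹) / x) ^ 2) m) (hD.nonneg (2 ^ j * ω))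
        have t2 := mul_le_mul_of_nonneg_left
          (one_sub_exp_le_tangent (((-ω - c * (2 ^ j)⁻¹) / x) ^ 2) m) (hD.nonneg (-(2 ^ j * ω)))
        rw [← hA, ← hB] at t1 t2
        refine (add_le_add t1 t2).trans_eq ?_
        ring
    _ ≤ A * 2 + B * (2 * m) := by
        rw [Finset.sum_add_distrib, ← Finset.mul_sum, ← Finset.mul_sum]
        have := hD.sum_le ω hω s
        gcongr
    _ = _ := by rw [hA, hB]; ring

/-- At scales `2ʲ ≤ 2ᴶ` the total mass of the dilates vanishes quadratically at frequency `0`. -/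
theorem exists_sum_le_sq (hD : IsAnalyticDensity D) (J : ℤ) :
    ∃ C : ℝ, 0 < C ∧ ∀ ω : ℝ, 0 < ω → ∀ s : Finset ℤ, (∀ j ∈ s, j ≤ J) →
      ∑ j ∈ s, (D (2 ^ j * ω) + D (-(2 ^ j * ω))) ≤ C * ω ^ 2 := by
  obtain ⟨K, hK, hmom⟩ := hD.exists_moment_le
  refine ⟨(2 ^ J) ^ 2 * K, by positivity, fun ω hω s hs => ?_⟩
  calc _ ≤ ∑ j ∈ s, (2 ^ J) ^ 2 *
        (((2 : ℝ) ^ j)⁻¹ ^ 2 * (D (2 ^ j * ω) + D (-(2 ^ j * ω)))) := by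
        refine Finset.sum_le_sum fun j hj => ?_
        have h1 : (1 : ℝ) ≤ (2 ^ J) ^ 2 * ((2 : ℝ) ^ j)⁻¹ ^ 2 := by
          rw [← mul_pow, ← div_eq_mul_inv]
          refine one_le_pow₀ ((one_le_div (by positivity)).2 ?_)
          exact zpow_le_zpow_right₀ (by norm_num) (hs j hj)
        rw [← mul_assoc]
        exact le_mul_of_one_le_left (add_nonneg (hD.nonneg _) (hD.nonneg _)) h1
    _ ≤ (2 ^ J) ^ 2 * (K * ω ^ 2) := by
        rw [← Finset.mul_sum]; gcongr; exact hmom ω hω s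
    _ = _ := by ring

/-- Gaussian bound for weighted sums, from a quadratic bound at low frequencies and a deficiency
of order `1 / ω` of the weights at high frequencies. -/
theorem exists_sum_weighted_le (hD : IsAnalyticDensity D) {J : ℤ} {C ρ c δ α β : ℝ}
    (hC : 0 < C) (hρ : 0 < ρ) (hc : 0 < c) (hδ : 0 < δ) (hCρ : C * ρ ^ 2 ≤ 1)
    (hlow : ∀ ω : ℝ, 0 < ω → ∀ s : Finset ℤ, (∀ j ∈ s, j ≤ J) →
      ∑ j ∈ s, (D (2 ^ j * ω) + D (-(2 ^ j * ω))) ≤ C * ω ^ 2)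
    (hgap : ∀ ω : ℝ, 0 < ω → ∃ j : ℤ,
      α ≤ 2 ^ j * ω ∧ 2 ^ j * ω ≤ β ∧ δ ≤ D (2 ^ j * ω) - D (-(2 ^ j * ω))) :
    ∃ x : ℝ, 0 < x ∧ ∀ W : ℤ → ℝ → ℝ, (∀ j u, W j u ≤ 1) →
      (∀ ω, ρ ≤ ω → ∀ j : ℤ, α ≤ 2 ^ j * ω → 2 ^ j * ω ≤ β → W j ω ≤ 1 - c / ω) →
      ∀ ω : ℝ, 0 < ω → ∀ s : Finset ℤ, (∀ j ∈ s, j ≤ J) →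
        ∑ j ∈ s, (D (2 ^ j * ω) * W j ω + D (-(2 ^ j * ω)) * W j (-ω)) ≤
          2 * (1 - Real.exp (-2 * (ω / x) ^ 2)) := by
  -- the square of the width: the three bounds serve the low frequencies, the case where the mass
  -- of the scale `j` is missing, and the case where it is weighted by `1 - c / ω`
  set X := min (2 / C) (min (δ * ρ ^ 2) (δ * c * ρ)) with hX
  have hX0 : 0 < X := lt_min (by positivity) (lt_min (by positivity) (by positivity))
  have hX1 : C * X ≤ 2 := by
    have : X ≤ 2 / C := min_le_left _ _
    rw [le_div_iff₀ hC] at this; linarith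
  have hX2 : X ≤ δ * ρ ^ 2 := (min_le_right _ _).trans (min_le_left _ _)
  have hX3 : X ≤ δ * c * ρ := (min_le_right _ _).trans (min_le_right _ _)
  refine ⟨Real.sqrt X, Real.sqrt_pos.2 hX0, fun W hW1 hW ω hω s hs => ?_⟩
  have hexp : Real.exp (-2 * (ω / Real.sqrt X) ^ 2) ≤ X / (X + 2 * ω ^ 2) := by
    have h := exp_neg_le_inv (y := 2 * (ω / Real.sqrt X) ^ 2) (by positivity)
    rw [neg_mul]
    refine h.trans_eq ?_
    rw [div_pow, Real.sq_sqrt hX0.le]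
    field_simp
  have hden : 0 < X + 2 * ω ^ 2 := by positivity
  have hmass : ∑ j ∈ s, (D (2 ^ j * ω) * W j ω + D (-(2 ^ j * ω)) * W j (-ω)) ≤
      ∑ j ∈ s, (D (2 ^ j * ω) + D (-(2 ^ j * ω))) := by
    refine Finset.sum_le_sum fun j _ => ?_
    exact add_le_add (mul_le_of_le_one_right (hD.nonneg _) (hW1 _ _))
      (mul_le_of_le_one_right (hD.nonneg _) (hW1 _ _))
  rcases le_total ω ρ with hωρ | hωρ
  · refine (hmass.trans (hlow ω hω s hs)).trans ?_
    have h2 : C * ω ^ 2 ≤ 2 * (1 - X / (X + 2 * ω ^ 2)) := by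
      have e : 2 * (1 - X / (X + 2 * ω ^ 2)) = 4 * ω ^ 2 / (X + 2 * ω ^ 2) := by
        field_simp; ring
      rw [e, le_div_iff₀ hden]
      have : C * ω ^ 2 ≤ 1 := le_trans (by gcongr) hCρ
      nlinarith [sq_nonneg ω]
    linarith
  · have hX4 : 2 * (X / (X + 2 * ω ^ 2)) ≤ X / ω ^ 2 := by
      rw [← mul_div_assoc, div_le_div_iff₀ hden (by positivity)]
      nlinarith [sq_nonneg ω, sq_nonneg X]
    obtain ⟨j, hj1, hj2, hj3⟩ := hgap ω hω
    by_cases hjs : j ∈ s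
    · have hdef : ∑ j ∈ s, (D (2 ^ j * ω) * W j ω + D (-(2 ^ j * ω)) * W j (-ω)) ≤
          2 - δ * (c / ω) := by
        have hall := hD.sum_le ω hω s
        rw [← Finset.add_sum_erase s _ hjs] at hall ⊢
        have hrest : ∑ j ∈ s.erase j, (D (2 ^ j * ω) * W j ω + D (-(2 ^ j * ω)) * W j (-ω)) ≤
            ∑ j ∈ s.erase j, (D (2 ^ j * ω) + D (-(2 ^ j * ω))) :=
          Finset.sum_le_sum fun j _ =>
            add_le_add (mul_le_of_le_one_right (hD.nonneg _) (hW1 _ _))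
              (mul_le_of_le_one_right (hD.nonneg _) (hW1 _ _))
        have h1 : D (2 ^ j * ω) * W j ω ≤ D (2 ^ j * ω) * (1 - c / ω) :=
          mul_le_mul_of_nonneg_left (hW ω hωρ j hj1 hj2) (hD.nonneg _)
        have h2 : D (-(2 ^ j * ω)) * W j (-ω) ≤ D (-(2 ^ j * ω)) :=
          mul_le_of_le_one_right (hD.nonneg _) (hW1 _ _)
        have h3 : δ * (c / ω) ≤ D (2 ^ j * ω) * (c / ω) := by
          gcongr; linarith [hD.nonneg (-(2 ^ j * ω))]
        linarith
      have : X / ω ^ 2 ≤ δ * (c / ω) := by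
        rw [← mul_div_assoc, div_le_div_iff₀ (by positivity) hω]
        have : δ * c * ρ ≤ δ * c * ω := by gcongr
        nlinarith
      linarith
    · have h1 := hD.sum_le_of_notMem hω hjs hj3
      have : X / ω ^ 2 ≤ δ := by
        rw [div_le_iff₀ (by positivity)]
        exact hX2.trans (by gcongr)
      linarith

end IsAnalyticDensity

/-! ### A nonnegative band-limited window -/

/-- There are nonnegative windows whose Fourier transform is supported in a prescribed interval:
take `|b̂|²` for a smooth even bump `b`, whose transform is `b ⋆ b`. -/
theorem exists_bandlimited_window {ρ : ℝ} (hρ : 0 < ρ) :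
    ∃ θ : ℝ → ℝ, (∀ t, 0 ≤ θ t) ∧ Integrable θ volume ∧ MemLp θ 2 volume ∧
      (∀ ω, ‖𝓕 (toComplexFun θ) ω‖ ^ 2 ≤ 1 / 2) ∧
      (∀ ω, ρ ≤ |ω| → 𝓕 (toComplexFun θ) ω = 0) ∧
      ∃ κ ρ' : ℝ, 0 < κ ∧ 0 < ρ' ∧ ρ' ≤ ρ ∧
        ∀ ω, |ω| ≤ ρ' → κ ≤ ‖𝓕 (toComplexFun θ) ω‖ ^ 2 := by
  let b : ContDiffBump (0 : ℝ) := ⟨ρ / 4, ρ / 2, by positivity, by linarith⟩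
  have hbs : HasCompactSupport (fun x => (b x : ℂ)) :=
    b.hasCompactSupport.comp_left (g := Complex.ofReal) rfl
  have hbc : ContDiff ℝ ((⊤ : ℕ∞) : WithTop ℕ∞) (fun x => (b x : ℂ)) :=
    Complex.ofRealCLM.contDiff.comp b.contDiff
  let B : SchwartzMap ℝ ℂ := hbs.toSchwartzMap hbc
  let Q : SchwartzMap ℝ ℂ := SchwartzMap.convolution (ContinuousLinearMap.mul ℂ ℂ) B B
  have hQ : ∀ x, Q x = ∫ s, (b s : ℂ) * (b (x - s) : ℂ) := fun x =>
    SchwartzMap.convolution_apply (ContinuousLinearMap.mul ℂ ℂ) B B x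
  have hBfun : (B : ℝ → ℂ) = toComplexFun (fun x => b x) := rfl
  -- the transform of the even real function `b` is real
  have hreal : ∀ t, (starRingEnd ℂ) (𝓕 (B : ℝ → ℂ) t) = 𝓕 (B : ℝ → ℂ) t := by
    intro t
    rw [hBfun, ← fourier_neg_of_real, ← Real.fourierInv_eq_fourier_neg,
      Real.fourierInv_eq_fourier_comp_neg]
    simp only [toComplexFun, b.neg]
    rfl
  have hFQ : ∀ t, 𝓕 (Q : ℝ → ℂ) t = ((‖𝓕 (B : ℝ → ℂ) t‖ ^ 2 : ℝ) : ℂ) := by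
    intro t
    have h := SchwartzMap.fourier_convolution_apply (ContinuousLinearMap.mul ℂ ℂ) B B t
    rw [Real.fourier_mul_convolution_eq B.integrable B.integrable] at h
    rw [← SchwartzMap.fourier_coe]
    refine h.trans ?_
    nth_rewrite 2 [← hreal t]
    rw [Complex.mul_conj, Complex.normSq_eq_norm_sq]
  obtain ⟨M, hM⟩ : ∃ M : ℝ, ∀ x, ‖Q x‖ ≤ M := ⟨_, SchwartzMap.norm_le_seminorm ℝ Q⟩
  set A : ℝ := (2 * (|M| + 1))⁻¹ with hA
  have hA0 : 0 < A := by positivity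
  set θ : ℝ → ℝ := fun t => A * ‖𝓕 (B : ℝ → ℂ) t‖ ^ 2 with hθ
  have hθC : toComplexFun θ = fun t => (A : ℂ) * (𝓕 Q : SchwartzMap ℝ ℂ) t := by
    ext t
    rw [SchwartzMap.fourier_coe, hFQ, toComplexFun, hθ]
    push_cast
    rfl
  have hFθ : ∀ ω, 𝓕 (toComplexFun θ) ω = (A : ℂ) * Q (-ω) := by
    intro ω
    have h1 : 𝓕 (toComplexFun θ) ω = (A : ℂ) * 𝓕 ((𝓕 Q : SchwartzMap ℝ ℂ) : ℝ → ℂ) ω := by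
      rw [hθC, Real.fourier_real_eq, Real.fourier_real_eq, ← integral_const_mul]
      congr 1 with t
      simp only [Circle.smul_def, smul_eq_mul]
      ring
    have h2 : 𝓕 ((𝓕 Q : SchwartzMap ℝ ℂ) : ℝ → ℂ) ω = Q (-ω) := by
      have := Real.fourierInv_eq_fourier_neg ((𝓕 Q : SchwartzMap ℝ ℂ) : ℝ → ℂ) (-ω)
      rw [neg_neg] at this
      rw [← this, ← SchwartzMap.fourierInv_coe, FourierTransform.fourierInv_fourier_eq]
    rw [h1, h2]
  have hθre : θ = fun t => (toComplexFun θ t).re := by ext t; simp [toComplexFun]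
  have hint : Integrable (toComplexFun θ) volume := by
    rw [hθC]; exact (𝓕 Q : SchwartzMap ℝ ℂ).integrable.const_mul _
  have hL2 : MemLp (toComplexFun θ) 2 volume := by
    rw [hθC]; exact ((𝓕 Q : SchwartzMap ℝ ℂ).memLp 2 volume).const_mul _
  have hQ0 : 0 < ‖Q 0‖ := by
    have h1 : Q 0 = ((∫ s, b s ^ 2 : ℝ) : ℂ) := by
      rw [hQ, ← integral_complex_ofReal]
      congr 1 with s
      rw [zero_sub, b.neg]; push_cast; ring
    have hc2 : Continuous fun s => b s ^ 2 := b.continuous.pow 2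
    have hs2 : HasCompactSupport fun s => b s ^ 2 :=
      b.hasCompactSupport.comp_left (g := fun y : ℝ => y ^ 2) (by norm_num)
    have h2 : 0 < ∫ s, b s ^ 2 := by
      refine hc2.integral_pos_of_hasCompactSupport_nonneg_nonzero (x := 0) hs2
        (fun s => by positivity) ?_
      have : 0 < b 0 := b.pos_of_mem_ball (Metric.mem_ball_self b.rOut_pos)
      positivity
    rw [h1, Complex.norm_real]
    exact norm_pos_iff.2 h2.ne'
  refine ⟨θ, fun t => by positivity, ?_, ?_, ?_, ?_, ?_⟩
  · rw [hθre]; exact hint.re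
  · rw [hθre]; exact hL2.re
  · intro ω
    rw [hFθ, norm_mul, Complex.norm_real, Real.norm_of_nonneg hA0.le]
    have h1 : A * ‖Q (-ω)‖ ≤ 1 / 2 := by
      rw [hA, inv_mul_eq_div, div_le_iff₀ (by positivity)]
      linarith [hM (-ω), le_abs_self M]
    have h0 : 0 ≤ A * ‖Q (-ω)‖ := by positivity
    nlinarith
  · intro ω hω
    rw [hFθ, hQ, integral_eq_zero_of_ae, mul_zero]
    refine Eventually.of_forall fun s => ?_
    have hz : ∀ y : ℝ, ρ / 2 ≤ |y| → b y = 0 := fun y hy =>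
      b.zero_of_le_dist (by rw [Real.dist_0_eq_abs]; exact hy)
    rcases le_total (ρ / 2) |s| with h | h
    · simp [hz s h]
    · have : ρ / 2 ≤ |-ω - s| := by
        have h3 : |ω| ≤ |-ω - s| + |s| := by
          calc |ω| = |(-ω - s) + s| := by rw [sub_add_cancel, abs_neg]
            _ ≤ _ := abs_add_le _ _
        linarith
      simp [hz _ this]
  · have hev : ∀ᶠ ω in 𝓝 (0 : ℝ), ‖Q 0‖ / 2 < ‖Q (-ω)‖ := by
      have hc : Continuous fun ω : ℝ => ‖Q (-ω)‖ := (Q.continuous.comp continuous_neg).norm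
      have := hc.tendsto 0
      rw [neg_zero] at this
      exact this.eventually (lt_mem_nhds (half_lt_self hQ0))
    obtain ⟨r, hr, hrb⟩ := Metric.eventually_nhds_iff.1 hev
    refine ⟨(A * (‖Q 0‖ / 2)) ^ 2, min (r / 2) ρ, by positivity, lt_min (by positivity) hρ,
      min_le_right _ _, fun ω hω => ?_⟩
    rw [hFθ, norm_mul, Complex.norm_real, Real.norm_of_nonneg hA0.le]
    gcongr
    refine (hrb ?_).le
    rw [Real.dist_0_eq_abs]
    have := hω.trans (min_le_left _ _)
    linarith

/-! ### Gaussians and wavelets -/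

/-- The real-valued Gaussian underlying `gaussianChi`. -/
def gaussianReal (x t : ℝ) : ℝ := Real.sqrt Real.pi * x * Real.exp (-(Real.pi * x) ^ 2 * t ^ 2)

theorem gaussianChi_eq (x : ℝ) : gaussianChi x = toComplexFun (gaussianReal x) := rfl

theorem gaussianReal_nonneg {x : ℝ} (hx : 0 < x) (t : ℝ) : 0 ≤ gaussianReal x t := by
  unfold gaussianReal; positivity

theorem integrable_gaussianReal {x : ℝ} (hx : 0 < x) : Integrable (gaussianReal x) volume :=
  (integrable_exp_neg_mul_sq (b := (Real.pi * x) ^ 2) (by positivity)).const_mul _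

theorem memLp_gaussianReal {x : ℝ} (hx : 0 < x) : MemLp (gaussianReal x) 2 volume := by
  refine MemLp.const_mul ?_ _
  rw [memLp_two_iff_integrable_sq (by fun_prop)]
  have h := integrable_exp_neg_mul_sq (b := 2 * (Real.pi * x) ^ 2) (by positivity)
  refine h.congr (Eventually.of_forall fun t => ?_)
  simp only
  rw [← Real.exp_nat_mul]
  congr 1
  push_cast
  ring

theorem fourier_gaussianChi {x : ℝ} (hx : 0 < x) (ω : ℝ) :
    𝓕 (gaussianChi x) ω = ((Real.exp (-(ω / x) ^ 2) : ℝ) : ℂ) := by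
  have hb : 0 < ((Real.pi * x ^ 2 : ℝ) : ℂ).re := by
    rw [Complex.ofReal_re]; positivity
  have h := congrFun (fourier_gaussian_pi hb) ω
  have e1 : gaussianChi x = fun t : ℝ => ((Real.sqrt Real.pi * x : ℝ) : ℂ) *
      Complex.exp (-Real.pi * ((Real.pi * x ^ 2 : ℝ) : ℂ) * t ^ 2) := by
    ext t
    rw [gaussianChi]
    push_cast
    congr 2
    ring
  have e2 : 𝓕 (gaussianChi x) ω = ((Real.sqrt Real.pi * x : ℝ) : ℂ) *
      𝓕 (fun t : ℝ => Complex.exp (-Real.pi * ((Real.pi * x ^ 2 : ℝ) : ℂ) * t ^ 2)) ω := by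
    rw [e1, Real.fourier_real_eq, Real.fourier_real_eq, ← integral_const_mul]
    congr 1 with t
    simp only [Circle.smul_def, smul_eq_mul]
    ring
  have e3 : ((Real.pi * x ^ 2 : ℝ) : ℂ) ^ (1 / 2 : ℂ) = ((Real.sqrt Real.pi * x : ℝ) : ℂ) := by
    have : (1 / 2 : ℂ) = ((1 / 2 : ℝ) : ℂ) := by push_cast; rfl
    rw [this, ← Complex.ofReal_cpow (by positivity), ← Real.sqrt_eq_rpow,
      Real.sqrt_mul Real.pi_pos.le, Real.sqrt_sq hx.le]
  have hne : ((Real.sqrt Real.pi * x : ℝ) : ℂ) ≠ 0 := by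
    rw [Ne, Complex.ofReal_eq_zero]; positivity
  rw [e2, h, e3, ← mul_assoc, mul_one_div_cancel hne, one_mul, Complex.ofReal_exp]
  congr 1
  have hpi : (Real.pi : ℂ) ≠ 0 := Complex.ofReal_ne_zero.2 Real.pi_ne_zero
  have hxC : (x : ℂ) ≠ 0 := Complex.ofReal_ne_zero.2 hx.ne'
  push_cast
  field_simp

theorem enorm_fourier_gaussianChi_sq {x : ℝ} (hx : 0 < x) (ω : ℝ) :
    ‖𝓕 (gaussianChi x) ω‖ₑ ^ 2 = ENNReal.ofReal (Real.exp (-2 * (ω / x) ^ 2)) := by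
  rw [fourier_gaussianChi hx, ← ofReal_norm, Complex.norm_real,
    Real.norm_of_nonneg (Real.exp_pos _).le, ← ENNReal.ofReal_pow (Real.exp_pos _).le,
    ← Real.exp_nat_mul]
  congr 2
  push_cast
  ring

theorem one_sub_enorm_fourier_gaussianChi_sq {x : ℝ} (hx : 0 < x) (ω : ℝ) :
    1 - ‖𝓕 (gaussianChi x) ω‖ₑ ^ 2 = ENNReal.ofReal (1 - Real.exp (-2 * (ω / x) ^ 2)) := by
  rw [enorm_fourier_gaussianChi_sq hx, ENNReal.ofReal_sub _ (Real.exp_pos _).le,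
    ENNReal.ofReal_one]

theorem integrable_wavelet {ψ : ℝ → ℂ} (hψ : Integrable ψ volume) (j : ℤ) :
    Integrable (wavelet ψ j) volume :=
  (hψ.comp_mul_left' (by positivity)).const_mul _

theorem memLp_wavelet {ψ : ℝ → ℂ} (hψ : MemLp ψ 2 volume) (j : ℤ) :
    MemLp (wavelet ψ j) 2 volume := by
  have h2 : (0 : ℝ) < 2 ^ (-j) := by positivity
  refine MemLp.const_mul ?_ _
  have hq : Measure.QuasiMeasurePreserving (fun t : ℝ => (2 : ℝ) ^ (-j) * t) volume volume := by
    refine ⟨by fun_prop, ?_⟩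
    rw [Real.map_volume_mul_left h2.ne']
    exact Measure.smul_absolutelyContinuous
  have hm : AEStronglyMeasurable (fun t : ℝ => ψ ((2 : ℝ) ^ (-j) * t)) volume :=
    hψ.1.comp_quasiMeasurePreserving hq
  rw [memLp_two_iff_integrable_sq_norm hm]
  exact ((memLp_two_iff_integrable_sq_norm hψ.1).1 hψ).comp_mul_left' h2.ne'

theorem fourier_wavelet (ψ : ℝ → ℂ) (j : ℤ) (ω : ℝ) :
    𝓕 (wavelet ψ j) ω = 𝓕 ψ (2 ^ j * ω) := by
  have h2 : (0 : ℝ) < 2 ^ (-j) := by positivity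
  rw [Real.fourier_real_eq, Real.fourier_real_eq]
  have h := Measure.integral_comp_mul_left
    (fun v : ℝ => Real.fourierChar (-(v * (2 ^ j * ω))) • ψ v) ((2 : ℝ) ^ (-j))
  rw [abs_inv, abs_of_pos h2] at h
  have e : ∀ t : ℝ, Real.fourierChar (-(t * ω)) • wavelet ψ j t = ((2 : ℝ) ^ (-j)) •
      (Real.fourierChar (-((2 : ℝ) ^ (-j) * t * (2 ^ j * ω))) • ψ ((2 : ℝ) ^ (-j) * t)) := by
    intro t
    have : (2 : ℝ) ^ (-j) * t * (2 ^ j * ω) = t * ω := by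
      rw [zpow_neg]; field_simp
    rw [this, wavelet]
    simp only [Circle.smul_def, smul_eq_mul, Complex.real_smul]
    ring
  simp_rw [e]
  rw [integral_smul, h, smul_smul, mul_inv_cancel₀ h2.ne', one_smul]

/-! ### The cascade energy -/

/-- The total energy of all paths of length `n` with scales at most `J`. -/
def cascadeEnergy (ψ : ℝ → ℂ) (J : ℤ) : ℕ → (ℝ → ℂ) → ENNReal
  | 0, f => energy f
  | n + 1, f => ∑' j : Set.Iic J, cascadeEnergy ψ J n (waveletModulus ψ f j)

/-- A path of length `n + 1` is its first scale followed by a path of length `n`. -/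
def consPathEquiv (J : ℤ) (n : ℕ) :
    Set.Iic J × pathsOfLength J n ≃ pathsOfLength J (n + 1) where
  toFun q := ⟨q.1.1 :: q.2.1, by
    refine ⟨fun j hj => ?_, by simp [q.2.2.2]⟩
    rcases List.mem_cons.1 hj with rfl | h
    · exact q.1.2
    · exact q.2.2.1 j h⟩
  invFun p := match p with
    | ⟨[], hp⟩ => absurd hp.2 (by simp)
    | ⟨j :: p, hp⟩ => (⟨j, hp.1 j (by simp)⟩,
        ⟨p, fun i hi => hp.1 i (by simp [hi]), by simpa using hp.2⟩)
  left_inv q := rfl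
  right_inv p := match p with
    | ⟨[], hp⟩ => absurd hp.2 (by simp)
    | ⟨j :: p, hp⟩ => rfl

theorem tsum_energy_scatteringU (ψ : ℝ → ℂ) (J : ℤ) (n : ℕ) (f : ℝ → ℂ) :
    ∑' p : pathsOfLength J n, energy (scatteringU ψ p f) = cascadeEnergy ψ J n f := by
  induction n generalizing f with
  | zero =>
    have huniq : ∀ p : pathsOfLength J 0, p = ⟨[], by simp [pathsOfLength]⟩ := fun p =>
      Subtype.ext (List.length_eq_zero_iff.1 p.2.2)
    rw [tsum_eq_single (⟨[], by simp [pathsOfLength]⟩ : pathsOfLength J 0)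
      fun p hp => absurd (huniq p) hp]
    rfl
  | succ n ih =>
    rw [← (consPathEquiv J n).tsum_eq, ENNReal.tsum_prod']
    simp only [cascadeEnergy]
    congr 1 with j
    rw [← ih]
    rfl

theorem memLp_norm_conv_wavelet {ψ f : ℝ → ℂ} (hψ : Integrable ψ volume) (hf : MemLp f 2 volume)
    (j : ℤ) : MemLp (fun t => ‖conv f (wavelet ψ j) t‖) 2 volume :=
  (memLp_conv hf (integrable_wavelet hψ j)).norm

theorem memLp_scatteringU {ψ : ℝ → ℂ} (hψ : Integrable ψ volume) (p : List ℤ) {f : ℝ → ℂ}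
    (hf : MemLp f 2 volume) : MemLp (scatteringU ψ p f) 2 volume := by
  induction p generalizing f with
  | nil => exact hf
  | cons j p ih => exact ih (memLp_toComplexFun (memLp_norm_conv_wavelet hψ hf j))

theorem enorm_fourier_wavelet_sq (ψ : ℝ → ℂ) (j : ℤ) (ω : ℝ) :
    ‖𝓕 (wavelet ψ j) ω‖ₑ ^ 2 = ENNReal.ofReal (‖𝓕 ψ (2 ^ j * ω)‖ ^ 2) := by
  rw [fourier_wavelet, ← ofReal_norm, ENNReal.ofReal_pow (norm_nonneg _)]

/-- Pointwise bounds on finitely many scales and positive frequencies control the cascade of a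
real function, whose spectral density is even. -/
theorem tsum_lintegral_spectralDensity_le {f : ℝ → ℝ} (hf : MemLp f 2 volume) {J : ℤ}
    {F : ℤ → ℝ → ENNReal} (hF : ∀ j, Measurable (F j)) {g : ℝ → ENNReal} (hg : ∀ ω, g (-ω) = g ω)
    (h : ∀ ω : ℝ, 0 < ω → ∀ s : Finset ℤ, (∀ j ∈ s, j ≤ J) →
      ∑ j ∈ s, (F j ω + F j (-ω)) ≤ 2 * g ω) :
    ∑' j : Set.Iic J, ∫⁻ ω, spectralDensity (toComplexFun f) ω * F j ω ≤
      ∫⁻ ω, spectralDensity (toComplexFun f) ω * g ω := by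
  have hS := measurable_spectralDensity (toComplexFun f)
  have hne : ∀ᵐ ω : ℝ, ω ≠ 0 := by simp [ae_iff, measure_singleton]
  have hpt : ∀ ω : ℝ, 0 < ω → ∑' j : Set.Iic J, (F j ω + F j (-ω)) ≤ 2 * g ω := by
    intro ω hω
    rw [ENNReal.tsum_eq_iSup_sum]
    refine iSup_le fun s => ?_
    have := h ω hω (s.map (Function.Embedding.subtype _)) (by
      intro j hj
      obtain ⟨i, -, rfl⟩ := Finset.mem_map.1 hj
      exact i.2)
    rwa [Finset.sum_map] at this
  have hFm : Measurable fun ω => ∑' j : Set.Iic J, F j ω := Measurable.tsum fun j => hF j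
  have hSF : ∀ j : Set.Iic J, AEMeasurable
      (fun ω => spectralDensity (toComplexFun f) ω * F j ω) volume :=
    fun j => (hS.mul (hF j)).aemeasurable
  rw [← lintegral_tsum hSF]
  simp_rw [ENNReal.tsum_mul_left]
  refine (ENNReal.mul_le_mul_iff_right (a := 2) (by norm_num) (by norm_num)).1 ?_
  rw [two_mul_lintegral_spectralDensity_mul hf hFm, ← lintegral_const_mul' _ _ (by norm_num)]
  refine lintegral_mono_ae ?_
  filter_upwards [hne] with ω hω
  rw [mul_left_comm]
  gcongr
  rw [← ENNReal.tsum_add]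
  rcases lt_or_gt_of_ne hω with h1 | h1
  · have := hpt (-ω) (by linarith)
    rw [hg, neg_neg] at this
    simpa only [add_comm] using this
  · exact hpt ω h1

theorem le_lintegral_average {S A q : ℝ → ENNReal} (hS : Measurable S) (hA : Measurable A)
    (hq : Measurable q) (μ : Measure ℝ) [IsProbabilityMeasure μ] {I : ENNReal}
    (h : ∀ ξ, I ≤ ∫⁻ ω, S ω * (A ω * (1 - q (ω - ξ)))) :
    I ≤ ∫⁻ ω, S ω * (A ω * ∫⁻ ξ, (1 - q (ω - ξ)) ∂μ) := by
  have hm : Measurable fun p : ℝ × ℝ => 1 - q (p.1 - p.2) :=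
    (hq.comp measurable_sub).const_sub 1
  have hu : Measurable (Function.uncurry fun ξ ω => S ω * (A ω * (1 - q (ω - ξ)))) :=
    (hS.comp measurable_snd).mul ((hA.comp measurable_snd).mul (hm.comp measurable_swap))
  calc I = ∫⁻ _, I ∂μ := by simp
    _ ≤ ∫⁻ ξ, (∫⁻ ω, S ω * (A ω * (1 - q (ω - ξ)))) ∂μ := lintegral_mono h
    _ = ∫⁻ ω, (∫⁻ ξ, S ω * (A ω * (1 - q (ω - ξ))) ∂μ) := lintegral_lintegral_swap hu.aemeasurable
    _ = _ := by
        congr 1 with ω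
        have hm' : Measurable fun ξ => 1 - q (ω - ξ) := hm.comp measurable_prodMk_left
        rw [lintegral_const_mul _ (hm'.const_mul _), lintegral_const_mul _ hm']

/-- One step of the cascade, for a nonnegative window `θ`: the energy of `|f ⋆ ψ_j|` outside the
window is at most that of `f ⋆ ψ_j` outside the window translated by a random frequency. -/
theorem lintegral_waveletModulus_le {ψ : ℝ → ℂ} (hψ : IsMotherWavelet ψ) {f : ℝ → ℂ}
    (hf : MemLp f 2 volume) {θ : ℝ → ℝ}
    (h0 : ∀ t, 0 ≤ θ t) (hθ1 : Integrable θ volume) (hθ2 : MemLp θ 2 volume)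
    (hθ : ∀ ω, ‖𝓕 (toComplexFun θ) ω‖ₑ ^ 2 ≤ 1) (j : ℤ) (μ : Measure ℝ) [IsProbabilityMeasure μ] :
    ∫⁻ ω, spectralDensity (waveletModulus ψ f j) ω * (1 - ‖𝓕 (toComplexFun θ) ω‖ₑ ^ 2) ≤
      ∫⁻ ω, spectralDensity f ω * (‖𝓕 (wavelet ψ j) ω‖ₑ ^ 2 *
        ∫⁻ ξ, (1 - ‖𝓕 (toComplexFun θ) (ω - ξ)‖ₑ ^ 2) ∂μ) := by
  have hw1 := integrable_wavelet hψ.integrable j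
  have hw2 := memLp_wavelet hψ.memLp_two j
  have hcont := continuous_fourier (u := toComplexFun θ) hθ1.ofReal
  have hwc := continuous_fourier hw1
  refine le_lintegral_average (q := fun u => ‖𝓕 (toComplexFun θ) u‖ₑ ^ 2)
    (measurable_spectralDensity f) (hwc.measurable.enorm.pow_const 2)
    (hcont.measurable.enorm.pow_const 2) μ fun ξ => ?_
  refine (lintegral_spectralDensity_norm_le (memLp_conv hf hw1) h0 hθ1 hθ2 hθ ξ).trans_eq ?_
  refine lintegral_congr_ae ?_
  filter_upwards [spectralDensity_conv hf hw1 hw2] with ω hω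
  rw [hω, mul_assoc]

/-- The uniform distribution on `[-L, L]`. -/
def uniformMeasure (L : ℝ) : Measure ℝ :=
  ENNReal.ofReal (2 * L)⁻¹ • volume.restrict (Set.Icc (-L) L)

theorem isProbabilityMeasure_uniformMeasure {L : ℝ} (hL : 0 < L) :
    IsProbabilityMeasure (uniformMeasure L) := ⟨by
  simp only [uniformMeasure, Measure.smul_apply, Measure.restrict_apply_univ, Real.volume_Icc,
    smul_eq_mul]
  rw [← ENNReal.ofReal_mul (by positivity), sub_neg_eq_add, ← two_mul,
    inv_mul_cancel₀ (by positivity), ENNReal.ofReal_one]⟩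

/-- Averaging a weight `1 - q`, where `q` is bounded below near `0`, over the translates in
`[-L, L]` leaves a deficiency of order `1 / L` at every frequency of that interval. -/
theorem toReal_lintegral_one_sub_le {q : ℝ → ENNReal} (hq : Measurable q) (hq1 : ∀ u, q u ≤ 1)
    {κ ρ L ω : ℝ} (hκ : 0 < κ) (hρ : 0 < ρ) (hκq : ∀ u, |u| ≤ ρ → ENNReal.ofReal κ ≤ q u)
    (hρω : ρ ≤ ω) (hωL : ω ≤ L) :
    (∫⁻ ξ, (1 - q (ω - ξ)) ∂(uniformMeasure L)).toReal ≤ 1 - κ * ((2 * L)⁻¹ * ρ) := by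
  have hL : 0 < L := by linarith
  have hprob := isProbabilityMeasure_uniformMeasure hL
  have hvol : uniformMeasure L (Set.Icc (ω - ρ) ω) = ENNReal.ofReal ((2 * L)⁻¹ * ρ) := by
    have hsub : Set.Icc (ω - ρ) ω ∩ Set.Icc (-L) L = Set.Icc (ω - ρ) ω :=
      Set.inter_eq_left.2 (Set.Icc_subset_Icc (by linarith) hωL)
    simp only [uniformMeasure, Measure.smul_apply, smul_eq_mul]
    rw [Measure.restrict_apply measurableSet_Icc, hsub, Real.volume_Icc,
      ← ENNReal.ofReal_mul (by positivity)]
    congr 2; ring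
  have hmass : ENNReal.ofReal (κ * ((2 * L)⁻¹ * ρ)) ≤ ∫⁻ ξ, q (ω - ξ) ∂(uniformMeasure L) := by
    calc _ = ∫⁻ _ in Set.Icc (ω - ρ) ω, ENNReal.ofReal κ ∂(uniformMeasure L) := by
          rw [setLIntegral_const, hvol, ENNReal.ofReal_mul hκ.le]
      _ ≤ ∫⁻ ξ in Set.Icc (ω - ρ) ω, q (ω - ξ) ∂(uniformMeasure L) := by
          refine setLIntegral_mono' measurableSet_Icc fun ξ hξ => hκq _ ?_
          rw [abs_le]
          exact ⟨by linarith [hξ.2], by linarith [hξ.1]⟩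
      _ ≤ _ := setLIntegral_le_lintegral _ _
  have hadd : ∫⁻ ξ, (1 - q (ω - ξ)) ∂(uniformMeasure L) +
      ∫⁻ ξ, q (ω - ξ) ∂(uniformMeasure L) = 1 := by
    have hqω : Measurable fun ξ => q (ω - ξ) := hq.comp (measurable_id.const_sub ω)
    rw [← lintegral_add_right _ hqω]
    simp_rw [fun ξ => tsub_add_cancel_of_le (hq1 (ω - ξ))]
    simp
  have hsum : ∫⁻ ξ, (1 - q (ω - ξ)) ∂(uniformMeasure L) +
      ENNReal.ofReal (κ * ((2 * L)⁻¹ * ρ)) ≤ 1 :=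
    (add_le_add le_rfl hmass).trans_eq hadd
  have hfin : ∫⁻ ξ, (1 - q (ω - ξ)) ∂(uniformMeasure L) ≠ ⊤ :=
    ((le_self_add.trans hadd.le).trans_lt ENNReal.one_lt_top).ne
  have := ENNReal.toReal_mono ENNReal.one_ne_top hsum
  rw [ENNReal.toReal_add hfin ENNReal.ofReal_ne_top, ENNReal.toReal_ofReal (by positivity),
    ENNReal.toReal_one] at this
  linarith

theorem enorm_sq_le_one_of_norm {z : ℂ} (hz : ‖z‖ ^ 2 ≤ 1) : ‖z‖ₑ ^ 2 ≤ 1 := by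
  rw [← ofReal_norm, ← ENNReal.ofReal_pow (norm_nonneg _)]
  exact ENNReal.ofReal_le_one.2 hz

theorem cascadeEnergy_one {ψ : ℝ → ℂ} (hψ : IsMotherWavelet ψ) (J : ℤ) {f : ℝ → ℂ}
    (hf : MemLp f 2 volume) : cascadeEnergy ψ J 1 f =
      ∑' j : Set.Iic J, ∫⁻ ω, spectralDensity f ω * ‖𝓕 (wavelet ψ j) ω‖ₑ ^ 2 := by
  simp only [cascadeEnergy]
  congr 1 with j
  rw [← energy_conv hf (integrable_wavelet hψ.integrable j) (memLp_wavelet hψ.memLp_two j)]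
  exact energy_norm _

/-- The induction step: the width of the Gaussian grows by a fixed factor `a > 1`. -/
theorem exists_cascadeEnergy_succ_le {ψ : ℝ → ℂ} (hψ : IsMotherWavelet ψ)
    (hD : IsAnalyticDensity fun u => ‖𝓕 ψ u‖ ^ 2) (J : ℤ) :
    ∃ a : ℝ, 1 < a ∧ ∀ x : ℝ, 0 < x → ∀ n : ℕ,
    (∀ f : ℝ → ℝ, MemLp f 2 volume → cascadeEnergy ψ J n (toComplexFun f) ≤
      ∫⁻ ω, spectralDensity (toComplexFun f) ω * (1 - ‖𝓕 (gaussianChi x) ω‖ₑ ^ 2)) →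
    ∀ f : ℝ → ℝ, MemLp f 2 volume → cascadeEnergy ψ J (n + 1) (toComplexFun f) ≤
      ∫⁻ ω, spectralDensity (toComplexFun f) ω *
        (1 - ‖𝓕 (gaussianChi (x * a)) ω‖ₑ ^ 2) := by
  obtain ⟨c, a, ha, hca⟩ := hD.exists_sum_gaussian_le
  refine ⟨a, ha, fun x hx n ih f hf => ?_⟩
  have hxa : 0 < x * a := by positivity
  have hfC := memLp_toComplexFun hf
  have hle : ∀ ω, ‖𝓕 (toComplexFun (gaussianReal x)) ω‖ₑ ^ 2 ≤ 1 := fun ω => by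
    rw [← gaussianChi_eq, enorm_fourier_gaussianChi_sq hx, ENNReal.ofReal_le_one,
      Real.exp_le_one_iff]
    nlinarith [sq_nonneg (ω / x)]
  have hstep : ∀ j : ℤ, cascadeEnergy ψ J n (waveletModulus ψ (toComplexFun f) j) ≤
      ∫⁻ ω, spectralDensity (toComplexFun f) ω * (‖𝓕 (wavelet ψ j) ω‖ₑ ^ 2 *
        ENNReal.ofReal (1 - Real.exp (-2 * ((ω - c * (2 ^ j)⁻¹) / x) ^ 2))) := by
    intro j
    refine (ih _ (memLp_norm_conv_wavelet hψ.integrable hfC j)).trans ?_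
    have h := lintegral_waveletModulus_le hψ hfC (gaussianReal_nonneg hx)
      (integrable_gaussianReal hx) (memLp_gaussianReal hx) hle j (Measure.dirac (c * (2 ^ j)⁻¹))
    simp only [lintegral_dirac, ← gaussianChi_eq,
      one_sub_enorm_fourier_gaussianChi_sq hx] at h ⊢
    exact h
  simp only [cascadeEnergy, one_sub_enorm_fourier_gaussianChi_sq hxa]
  refine (ENNReal.tsum_le_tsum fun j : Set.Iic J => hstep j).trans ?_
  refine tsum_lintegral_spectralDensity_le hf (F := fun j ω => ‖𝓕 (wavelet ψ j) ω‖ₑ ^ 2 *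
        ENNReal.ofReal (1 - Real.exp (-2 * ((ω - c * (2 ^ j)⁻¹) / x) ^ 2))) (fun j => ?_)
    (fun ω => by rw [neg_div, neg_sq]) fun ω hω s _ => ?_
  · have := (continuous_fourier (integrable_wavelet hψ.integrable j)).measurable
    fun_prop
  · have h := ENNReal.ofReal_le_ofReal (hca x hx ω hω s)
    have hnn : ∀ y : ℝ, 0 ≤ 1 - Real.exp (-2 * y ^ 2) := fun y => by
      rw [sub_nonneg, Real.exp_le_one_iff]; nlinarith [sq_nonneg y]
    have hnn2 : ∀ y u : ℝ, 0 ≤ ‖𝓕 ψ u‖ ^ 2 * (1 - Real.exp (-2 * y ^ 2)) := fun y u =>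
      mul_nonneg (by positivity) (hnn y)
    rw [ENNReal.ofReal_sum_of_nonneg fun j _ => add_nonneg (hnn2 _ _) (hnn2 _ _),
      ENNReal.ofReal_mul (by norm_num), ENNReal.ofReal_ofNat] at h
    refine le_trans (le_of_eq (Finset.sum_congr rfl fun j _ => ?_)) h
    rw [ENNReal.ofReal_add (hnn2 _ _) (hnn2 _ _), ENNReal.ofReal_mul (by positivity),
      ENNReal.ofReal_mul (by positivity), enorm_fourier_wavelet_sq, enorm_fourier_wavelet_sq,
      mul_neg]

/-- The energy after one step misses a window around the frequency `0`, because scales above `J` are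
excluded. -/
theorem cascadeEnergy_one_le {ψ : ℝ → ℂ} (hψ : IsMotherWavelet ψ)
    (hD : IsAnalyticDensity fun u => ‖𝓕 ψ u‖ ^ 2) {J : ℤ} {C ρ : ℝ} (hC : 0 < C) (hCρ : C * ρ ^ 2 ≤ 1)
    (hlow : ∀ ω : ℝ, 0 < ω → ∀ s : Finset ℤ, (∀ j ∈ s, j ≤ J) →
      ∑ j ∈ s, (‖𝓕 ψ (2 ^ j * ω)‖ ^ 2 + ‖𝓕 ψ (-(2 ^ j * ω))‖ ^ 2) ≤ C * ω ^ 2)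
    {θ : ℝ → ℝ} (hθ : ∀ ω, ‖𝓕 (toComplexFun θ) ω‖ ^ 2 ≤ 1 / 2)
    (hθρ : ∀ ω, ρ ≤ |ω| → 𝓕 (toComplexFun θ) ω = 0) {f : ℝ → ℝ} (hf : MemLp f 2 volume) :
    cascadeEnergy ψ J 1 (toComplexFun f) ≤
      ∫⁻ ω, spectralDensity (toComplexFun f) ω * (1 - ‖𝓕 (toComplexFun θ) ω‖ₑ ^ 2) := by
  have hconv : ∀ ω, 1 - ‖𝓕 (toComplexFun θ) ω‖ₑ ^ 2 =
      ENNReal.ofReal (1 - ‖𝓕 (toComplexFun θ) ω‖ ^ 2) := fun ω => by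
    rw [ENNReal.ofReal_sub _ (by positivity), ENNReal.ofReal_one,
      ENNReal.ofReal_pow (norm_nonneg _), ofReal_norm]
  rw [cascadeEnergy_one hψ J (memLp_toComplexFun hf)]
  refine tsum_lintegral_spectralDensity_le hf (F := fun j ω => ‖𝓕 (wavelet ψ j) ω‖ₑ ^ 2)
    (fun j => ?_) (fun ω => ?_) fun ω hω s hs => ?_
  · have := (continuous_fourier (integrable_wavelet hψ.integrable j)).measurable
    fun_prop
  · rw [fourier_neg_of_real, ← ofReal_norm, ← ofReal_norm, Complex.norm_conj]
  · have hreal : ∑ j ∈ s, (‖𝓕 ψ (2 ^ j * ω)‖ ^ 2 + ‖𝓕 ψ (-(2 ^ j * ω))‖ ^ 2) ≤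
        2 * (1 - ‖𝓕 (toComplexFun θ) ω‖ ^ 2) := by
      rcases le_total ρ |ω| with h | h
      · rw [hθρ ω h]
        simpa using hD.sum_le ω hω s
      · refine (hlow ω hω s hs).trans ?_
        rw [abs_of_pos hω] at h
        have : C * ω ^ 2 ≤ C * ρ ^ 2 := by gcongr
        linarith [hθ ω]
    have h := ENNReal.ofReal_le_ofReal hreal
    rw [ENNReal.ofReal_sum_of_nonneg fun j _ => by positivity,
      ENNReal.ofReal_mul (by norm_num), ENNReal.ofReal_ofNat] at h
    rw [hconv]
    refine le_trans (le_of_eq (Finset.sum_congr rfl fun j _ => ?_)) h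
    rw [ENNReal.ofReal_add (by positivity) (by positivity), enorm_fourier_wavelet_sq,
      enorm_fourier_wavelet_sq, mul_neg]

/-- The base case `n = 2`. The first modulus moves energy to the low frequencies that the second
step misses; averaging the translates of a fixed window over the frequencies up to `2⁻ʲ` shows
that a fraction of order `1 / |ω|` is lost, which is more than a Gaussian tail. -/
theorem exists_cascadeEnergy_two_le {ψ : ℝ → ℂ} (hψ : IsMotherWavelet ψ)
    (hD : IsAnalyticDensity fun u => ‖𝓕 ψ u‖ ^ 2) (J : ℤ) : ∃ x : ℝ, 0 < x ∧
    ∀ f : ℝ → ℝ, MemLp f 2 volume → cascadeEnergy ψ J 2 (toComplexFun f) ≤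
      ∫⁻ ω, spectralDensity (toComplexFun f) ω * (1 - ‖𝓕 (gaussianChi x) ω‖ₑ ^ 2) := by
  obtain ⟨C, hC, hlow⟩ := hD.exists_sum_le_sq J
  obtain ⟨δ, α, β, hδ, hα, hβ, hgap⟩ := hD.exists_gap
  have hβ0 : 0 < β := by linarith
  obtain ⟨ρ, hρ, hCρ⟩ : ∃ ρ : ℝ, 0 < ρ ∧ C * ρ ^ 2 ≤ 1 := by
    refine ⟨Real.sqrt C⁻¹, Real.sqrt_pos.2 (by positivity), ?_⟩
    rw [Real.sq_sqrt (by positivity), mul_inv_cancel₀ hC.ne']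
  obtain ⟨θ, h0, hθ1, hθ2, hθ, hθρ, κ, ρ', hκ, hρ', hρρ', hκθ⟩ := exists_bandlimited_window hρ
  have hCρ' : C * ρ' ^ 2 ≤ 1 := le_trans (by gcongr) hCρ
  set c := κ * (ρ' * α / (2 * β)) with hc
  obtain ⟨x, hx, hxW⟩ := hD.exists_sum_weighted_le hC hρ' (c := c) (by positivity) hδ hCρ' hlow
    hgap
  refine ⟨x, hx, fun f hf => ?_⟩
  have hfC := memLp_toComplexFun hf
  have hle : ∀ ω, ‖𝓕 (toComplexFun θ) ω‖ₑ ^ 2 ≤ 1 := fun ω =>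
    enorm_sq_le_one_of_norm ((hθ ω).trans (by norm_num))
  have hcont := continuous_fourier (u := toComplexFun θ) hθ1.ofReal
  let L : ℤ → ℝ := fun j => β * (2 ^ j)⁻¹
  have hL : ∀ j, 0 < L j := fun j => by positivity
  have hμ : ∀ j, IsProbabilityMeasure (uniformMeasure (L j)) := fun j =>
    isProbabilityMeasure_uniformMeasure (hL j)
  let q : ℝ → ENNReal := fun ω => ‖𝓕 (toComplexFun θ) ω‖ₑ ^ 2
  have hq : Measurable q := hcont.measurable.enorm.pow_const 2
  let V : ℤ → ℝ → ENNReal := fun j ω => ∫⁻ ξ, (1 - q (ω - ξ)) ∂(uniformMeasure (L j))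
  have hVm : ∀ j, Measurable (V j) := fun j => by
    have hm : Measurable fun p : ℝ × ℝ => 1 - q (p.1 - p.2) :=
      (hq.comp measurable_sub).const_sub 1
    exact hm.lintegral_prod_right'
  have hV1 : ∀ j ω, V j ω ≤ 1 := fun j ω => by
    calc V j ω ≤ ∫⁻ _, 1 ∂(uniformMeasure (L j)) := lintegral_mono fun ξ => tsub_le_self
      _ = 1 := by simp
  have hVtop : ∀ j ω, V j ω ≠ ⊤ := fun j ω => ((hV1 j ω).trans_lt ENNReal.one_lt_top).ne
  have hVlow : ∀ ω, ρ' ≤ ω → ∀ j : ℤ, α ≤ 2 ^ j * ω → 2 ^ j * ω ≤ β →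
      (V j ω).toReal ≤ 1 - c / ω := by
    intro ω hω j hj1 hj2
    have hω0 : 0 < ω := by linarith
    have h2j : (0 : ℝ) < 2 ^ j := by positivity
    have hLj := hL j
    have hωL : ω ≤ L j := by
      simp only [L]
      rw [← div_eq_mul_inv, le_div_iff₀ h2j]; linarith
    have hLω : L j * α ≤ β * ω := by
      simp only [L]
      rw [mul_assoc]
      gcongr
      rw [inv_mul_eq_div, div_le_iff₀ h2j]; linarith
    refine (toReal_lintegral_one_sub_le hq hle hκ hρ' (fun u hu => ?_) hω hωL).trans ?_
    · simp only [q]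
      rw [← ofReal_norm, ← ENNReal.ofReal_pow (norm_nonneg _)]
      exact ENNReal.ofReal_le_ofReal (hκθ u hu)
    · refine sub_le_sub_left ?_ 1
      rw [hc, mul_div_assoc]
      gcongr
      rw [inv_mul_eq_div, div_div, div_le_div_iff₀ (by positivity) (by positivity)]
      nlinarith
  have hstep : ∀ j : ℤ, cascadeEnergy ψ J 1 (waveletModulus ψ (toComplexFun f) j) ≤
      ∫⁻ ω, spectralDensity (toComplexFun f) ω * (‖𝓕 (wavelet ψ j) ω‖ₑ ^ 2 * V j ω) := fun j =>
    (cascadeEnergy_one_le hψ hD hC hCρ hlow hθ hθρ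
      (memLp_norm_conv_wavelet hψ.integrable hfC j)).trans
      (lintegral_waveletModulus_le hψ hfC h0 hθ1 hθ2 hle j (uniformMeasure (L j)))
  rw [cascadeEnergy]
  simp only [one_sub_enorm_fourier_gaussianChi_sq hx]
  refine (ENNReal.tsum_le_tsum fun j : Set.Iic J => hstep j).trans ?_
  refine tsum_lintegral_spectralDensity_le hf
    (F := fun j ω => ‖𝓕 (wavelet ψ j) ω‖ₑ ^ 2 * V j ω) (fun j => ?_)
    (fun ω => by rw [neg_div, neg_sq]) fun ω hω s hs => ?_
  · have := (continuous_fourier (integrable_wavelet hψ.integrable j)).measurable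
    exact (this.enorm.pow_const 2).mul (hVm j)
  · have h := ENNReal.ofReal_le_ofReal (hxW (fun j u => (V j u).toReal) (fun j u => by
      simpa using ENNReal.toReal_mono ENNReal.one_ne_top (hV1 j u)) hVlow ω hω s hs)
    have hnn : ∀ j y u, 0 ≤ ‖𝓕 ψ y‖ ^ 2 * (V j u).toReal := fun j y u => by positivity
    rw [ENNReal.ofReal_sum_of_nonneg fun j _ => add_nonneg (hnn j _ _) (hnn j _ _),
      ENNReal.ofReal_mul (by norm_num), ENNReal.ofReal_ofNat] at h
    refine le_trans (le_of_eq (Finset.sum_congr rfl fun j _ => ?_)) h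
    rw [ENNReal.ofReal_add (hnn j _ _) (hnn j _ _), ENNReal.ofReal_mul (by positivity),
      ENNReal.ofReal_mul (by positivity), enorm_fourier_wavelet_sq, enorm_fourier_wavelet_sq,
      mul_neg, ENNReal.ofReal_toReal (hVtop _ _), ENNReal.ofReal_toReal (hVtop _ _)]

theorem exists_cascadeEnergy_le {ψ : ℝ → ℂ} (hψ : IsMotherWavelet ψ)
    (hD : IsAnalyticDensity fun u => ‖𝓕 ψ u‖ ^ 2) (J : ℤ) :
    ∃ r a : ℝ, 0 < r ∧ 1 < a ∧ ∀ n : ℕ, 2 ≤ n →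
    ∀ f : ℝ → ℝ, MemLp f 2 volume → cascadeEnergy ψ J n (toComplexFun f) ≤
      ∫⁻ ω, spectralDensity (toComplexFun f) ω *
        (1 - ‖𝓕 (gaussianChi (r * a ^ n)) ω‖ₑ ^ 2) := by
  obtain ⟨x, hx, hbase⟩ := exists_cascadeEnergy_two_le hψ hD J
  obtain ⟨a, ha, hstep⟩ := exists_cascadeEnergy_succ_le hψ hD J
  have ha0 : 0 < a := by linarith
  refine ⟨x / a ^ 2, a, by positivity, ha, fun n hn => ?_⟩
  induction n, hn using Nat.le_induction with
  | base => rwa [div_mul_cancel₀ _ (by positivity)]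
  | succ n hn ih =>
    have h := hstep _ (by positivity) n ih
    rwa [mul_assoc, ← pow_succ] at h

/-- The hypotheses on the wavelet give the properties of `|ψ̂|²` used in the proof. -/
theorem isAnalyticDensity {ψ : ℝ → ℂ} (hψ : IsMotherWavelet ψ)
    (hLP : ∀ ω : ℝ, (1 / 2 : ENNReal) *
      ∑' j : ℤ, (‖𝓕 (wavelet ψ j) ω‖ₑ ^ 2 + ‖𝓕 (wavelet ψ j) (-ω)‖ₑ ^ 2) ≤ 1)
    (hneg : ∀ j : ℤ, ∀ ω : ℝ, 0 < ω → ‖𝓕 (wavelet ψ j) (-ω)‖ ≤ ‖𝓕 (wavelet ψ j) ω‖)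
    (hstrict : ∀ ω : ℝ, 0 < ω → ∃ j : ℤ, ‖𝓕 (wavelet ψ j) (-ω)‖ < ‖𝓕 (wavelet ψ j) ω‖)
    (hzero : ∃ ε : ℝ, 0 < ε ∧ (𝓕 ψ) =O[𝓝[≠] 0] (fun ω : ℝ => |ω| ^ (1 + ε))) :
    IsAnalyticDensity fun u => ‖𝓕 ψ u‖ ^ 2 where
  nonneg u := by positivity
  continuous := (continuous_fourier hψ.integrable).norm.pow 2
  sum_le ω _ s := by
    have h1 : ∑ j ∈ s, (‖𝓕 (wavelet ψ j) ω‖ₑ ^ 2 + ‖𝓕 (wavelet ψ j) (-ω)‖ₑ ^ 2) ≤ 2 := by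
      refine (ENNReal.sum_le_tsum s).trans ?_
      have h := mul_le_mul_right (hLP ω) 2
      rw [← mul_assoc, one_div, ENNReal.mul_inv_cancel (by norm_num) (by norm_num), one_mul,
        mul_one] at h
      exact h
    have h2 : ENNReal.ofReal (∑ j ∈ s, (‖𝓕 ψ (2 ^ j * ω)‖ ^ 2 + ‖𝓕 ψ (-(2 ^ j * ω))‖ ^ 2)) ≤
        ENNReal.ofReal 2 := by
      rw [ENNReal.ofReal_sum_of_nonneg fun j _ => by positivity, ENNReal.ofReal_ofNat]
      refine le_trans (le_of_eq (Finset.sum_congr rfl fun j _ => ?_)) h1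
      rw [ENNReal.ofReal_add (by positivity) (by positivity), enorm_fourier_wavelet_sq,
        enorm_fourier_wavelet_sq, mul_neg]
    exact (ENNReal.ofReal_le_ofReal_iff (by norm_num)).1 h2
  neg_le u hu := by
    have h := hneg 0 u hu
    simp only [fourier_wavelet, zpow_zero, one_mul] at h
    gcongr
  exists_neg_lt ω hω := by
    obtain ⟨j, hj⟩ := hstrict ω hω
    simp only [fourier_wavelet, mul_neg] at hj
    exact ⟨j, by gcongr⟩
  vanishing := by
    obtain ⟨ε, hε, hO⟩ := hzero
    obtain ⟨C, hC, hb⟩ := hO.exists_pos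
    rw [IsBigOWith, eventually_nhdsWithin_iff, Metric.eventually_nhds_iff] at hb
    obtain ⟨u₀, hu₀, hb⟩ := hb
    refine ⟨2 * ε, C ^ 2, u₀, by positivity, by positivity, hu₀, fun u hu huu => ?_⟩
    have h := hb (by rwa [Real.dist_0_eq_abs]) hu
    have hpos : 0 < |u| := abs_pos.2 hu
    rw [Real.norm_of_nonneg (by positivity)] at h
    calc ‖𝓕 ψ u‖ ^ 2 ≤ (C * |u| ^ (1 + ε)) ^ 2 := by gcongr
      _ = _ := by
        rw [mul_pow, ← Real.rpow_mul_natCast hpos.le]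
        congr 2; push_cast; ring

/-- The spectral form of the energy missed by a Gaussian low-pass filter. -/
theorem lintegral_mul_one_sub_gaussianChi {f : ℝ → ℂ} (hf : MemLp f 2 volume) {x : ℝ}
    (hx : 0 < x) :
    energy (conv f (gaussianChi x)) +
      ∫⁻ ω, spectralDensity f ω * (1 - ‖𝓕 (gaussianChi x) ω‖ₑ ^ 2) = energy f := by
  have h1 : Integrable (gaussianChi x) volume := (integrable_gaussianReal hx).ofReal
  have h2 : MemLp (gaussianChi x) 2 volume := memLp_toComplexFun (memLp_gaussianReal hx)
  have hm : Measurable fun ω => spectralDensity f ω * ‖𝓕 (gaussianChi x) ω‖ₑ ^ 2 :=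
    (measurable_spectralDensity f).mul ((continuous_fourier h1).measurable.enorm.pow_const 2)
  rw [energy_conv hf h1 h2, ← lintegral_spectralDensity hf, ← lintegral_add_left hm]
  congr 1 with ω
  have hle : ‖𝓕 (gaussianChi x) ω‖ₑ ^ 2 ≤ 1 := by
    rw [enorm_fourier_gaussianChi_sq hx, ENNReal.ofReal_le_one, Real.exp_le_one_iff]
    nlinarith [sq_nonneg (ω / x)]
  rw [← mul_add, add_tsub_cancel_of_le hle, mul_one]

end Scattering

end

open Scattering in
theorem theorem2 (ψ : ℝ → ℂ) (hψ : IsMotherWavelet ψ)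
    (hLP : ∀ ω : ℝ, (1 / 2 : ENNReal) *
      ∑' j : ℤ, (‖𝓕 (wavelet ψ j) ω‖ₑ ^ 2 + ‖𝓕 (wavelet ψ j) (-ω)‖ₑ ^ 2) ≤ 1)
    (hneg : ∀ j : ℤ, ∀ ω : ℝ, 0 < ω → ‖𝓕 (wavelet ψ j) (-ω)‖ ≤ ‖𝓕 (wavelet ψ j) ω‖)
    (hstrict : ∀ ω : ℝ, 0 < ω → ∃ j : ℤ, ‖𝓕 (wavelet ψ j) (-ω)‖ < ‖𝓕 (wavelet ψ j) ω‖)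
    (hzero : ∃ ε : ℝ, 0 < ε ∧ (𝓕 ψ) =O[𝓝[≠] 0] (fun ω : ℝ => |ω| ^ (1 + ε)))
    (J : ℤ) :
    ∃ r a : ℝ, 0 < r ∧ 1 < a ∧
      ∀ n : ℕ, 2 ≤ n → ∀ (f : ℝ → ℝ) (hf : MemLp f 2 volume),
        (∀ p ∈ pathsOfLength J n, MemLp (scatteringU ψ p (toComplexFun f)) 2 volume) ∧
        MemLp (conv (toComplexFun f) (gaussianChi (r * a ^ n))) 2 volume ∧
        Summable (fun p : pathsOfLength J n =>
          normSqL2 (scatteringU ψ (p : List ℤ) (toComplexFun f))) ∧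
        ∑' p : pathsOfLength J n, normSqL2 (scatteringU ψ (p : List ℤ) (toComplexFun f))
          ≤ normSqL2 (toComplexFun f)
            - normSqL2 (conv (toComplexFun f) (gaussianChi (r * a ^ n))) ∧
        Integrable (fun ω : ℝ =>
          ‖fourierL2 f hf ω‖ ^ 2 * (1 - ‖𝓕 (gaussianChi (r * a ^ n)) ω‖ ^ 2)) volume ∧
        normSqL2 (toComplexFun f)
            - normSqL2 (conv (toComplexFun f) (gaussianChi (r * a ^ n)))
          = ∫ ω : ℝ, ‖fourierL2 f hf ω‖ ^ 2
              * (1 - ‖𝓕 (gaussianChi (r * a ^ n)) ω‖ ^ 2) := by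
  obtain ⟨r, a, hr, ha, hdecay⟩ :=
    exists_cascadeEnergy_le hψ (isAnalyticDensity hψ hLP hneg hstrict hzero) J
  refine ⟨r, a, hr, ha, fun n hn f hf => ?_⟩
  have ha0 : 0 < a := by linarith
  set x := r * a ^ n with hxdef
  have hx : 0 < x := by positivity
  have hfC := memLp_toComplexFun hf
  have hχ1 : Integrable (gaussianChi x) volume := (integrable_gaussianReal hx).ofReal
  have hsplit := lintegral_mul_one_sub_gaussianChi hfC hx
  set I := ∫⁻ ω, spectralDensity (toComplexFun f) ω * (1 - ‖𝓕 (gaussianChi x) ω‖ₑ ^ 2) with hI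
  have hconvL := memLp_conv hfC hχ1
  have hItop : I ≠ ⊤ := by
    refine (lt_of_le_of_lt ?_ (energy_lt_top hfC)).ne
    rw [← hsplit]; exact le_add_self
  have hdiff : normSqL2 (toComplexFun f) - normSqL2 (conv (toComplexFun f) (gaussianChi x)) =
      I.toReal := by
    rw [normSqL2_eq, normSqL2_eq, ← hsplit,
      ENNReal.toReal_add (energy_lt_top hconvL).ne hItop]
    ring
  have hsum := tsum_energy_scatteringU ψ J n (toComplexFun f)
  have hle := hdecay n hn f hf
  rw [← hxdef, ← hI] at hle
  have hsumtop : ∑' p : pathsOfLength J n, energy (scatteringU ψ p (toComplexFun f)) ≠ ⊤ := by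
    rw [hsum]; exact (lt_of_le_of_lt hle (lt_top_iff_ne_top.2 hItop)).ne
  set g : ℝ → ℝ := fun ω => ‖fourierL2 f hf ω‖ ^ 2 * (1 - ‖𝓕 (gaussianChi x) ω‖ ^ 2) with hg
  have hg0 : ∀ ω, 0 ≤ g ω := fun ω => by
    refine mul_nonneg (by positivity) ?_
    rw [fourier_gaussianChi hx, Complex.norm_real, Real.norm_of_nonneg (Real.exp_pos _).le,
      sub_nonneg]
    refine pow_le_one₀ (Real.exp_pos _).le ?_
    rw [Real.exp_le_one_iff]
    nlinarith [sq_nonneg (ω / x)]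
  have hgI : ∫⁻ ω, ENNReal.ofReal (g ω) = I := by
    rw [hI]
    congr 1 with ω
    rw [hg, ENNReal.ofReal_mul (by positivity), ENNReal.ofReal_sub _ (by positivity),
      ENNReal.ofReal_one, ENNReal.ofReal_pow (norm_nonneg _), ENNReal.ofReal_pow (norm_nonneg _),
      ofReal_norm, ofReal_norm, spectralDensity, l2Fourier_eq hfC]
    rfl
  have hgm : AEStronglyMeasurable g volume := by
    refine AEStronglyMeasurable.mul ((Lp.aestronglyMeasurable _).norm.pow 2) ?_
    exact (continuous_const.sub ((continuous_fourier hχ1).norm.pow 2)).aestronglyMeasurable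
  refine ⟨fun p _ => memLp_scatteringU hψ.integrable p hfC, hconvL, ?_, ?_, ?_, ?_⟩
  · simp_rw [normSqL2_eq]
    exact ENNReal.summable_toReal hsumtop
  · simp_rw [normSqL2_eq (scatteringU _ _ _)]
    rw [hdiff, ← ENNReal.tsum_toReal_eq fun p => ENNReal.ne_top_of_tsum_ne_top hsumtop p, hsum]
    exact ENNReal.toReal_mono hItop hle
  · refine ⟨hgm, ?_⟩
    rw [hasFiniteIntegral_iff_ofReal (Eventually.of_forall hg0), hgI]
    exact lt_top_iff_ne_top.2 hItop
  · rw [hdiff, integral_eq_lintegral_of_nonneg_ae (Eventually.of_forall hg0) hgm, hgI]
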